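/- A (quasi-real-time) deque automaton is a tuple $M=(\Sigma,\Gamma,Q,q_0,\delta,F)$ with a finite input alphabet $\Sigma$, a finite deque alphabet $\Gamma$, a finite set $Q$ of states, an initial state $q_0\in Q$, a set $F\subseteq Q$ of final states, and a finite transition relation $\delta\subseteq Q\times(\Sigma\cup\{\varepsilon\})\times\Gamma^*\times\Gamma^*\times Q\times\Gamma^*\times\Gamma^*$. A configuration is a triple $(q,u,\gamma)\in Q\times\Sigma^*\times\Gamma^*$ (state, unread input, deque content from front to tail), and $(q,au,\gamma_l\gamma\gamma_r)\to_M(q',u,\sigma\gamma\rho)$ is a move for all $u\in\Sigma^*$, $\gamma\in\Gamma^*$ and $(q,a,\gamma_l,\gamma_r,q',\sigma,\rho)\in\delta$. It is required that there is a constant $p\ge 1$ such that in every computation from an initial configuration $(q_0,w,\varepsilon)$, $w\in\Sigma^*$, every sequence of $p$ consecutive moves consumes at least one input letter. $M$ accepts $w$ if some sequence of moves leads from $(q_0,w,\varepsilon)$ to $(q,\varepsilon,\varepsilon)$ with $q\in F$. A language over a finite alphabet is a deque language if it is the set of words accepted by some deque automaton. An abstract family of languages (AFL) is a family of languages over finite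 alphabets that contains a nonempty language and is closed under union, concatenation, Kleene plus, intersection with regular languages, nonerasing homomorphism (no letter is mapped to the empty word), and arbitrary inverse homomorphism. A full AFL is an AFL that is closed under arbitrary homomorphisms. **Proposition.** The family of deque languages is an AFL, and it is also closed under Kleene star. It is not closed under arbitrary (possibly erasing) homomorphisms; hence it is not a full AFL. -/

import Mathlib

namespace DequeAFL

open scoped Computability

/-- A transition `(q, a, γ_l, γ_r, q', σ, ρ)` of a deque automaton with terminal alphabet `α`, deque
alphabet `Γ` and state set `Q`; `input = none` stands for `a = ε`. -/
structure Transition (α Γ Q : Type) where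
  /-- the present state `q` -/
  src : Q
  /-- the terminal letter consumed, if any -/
  input : Option α
  /-- the word `γ_l` removed at the front of the deque -/
  readFront : List Γ
  /-- the word `γ_r` removed at the tail of the deque -/
  readTail : List Γ
  /-- the next state `q'` -/
  dst : Q
  /-- the word `σ` written at the front of the deque -/
  writeFront : List Γ
  /-- the word `ρ` written at the tail of the deque -/
  writeTail : List Γ

/-- A (nondeterministic) deque automaton: finitely many transitions, an initial state and a set of
final states. Finiteness of `α`, `Γ`, `Q` and quasi-real-time operation are imposed where the
automaton is used. -/
structure Automaton (α Γ Q : Type) where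
  start : Q
  final : Set Q
  trans : Set (Transition α Γ Q)
  trans_finite : trans.Finite

/-- A configuration `(q, u, γ)`: state, input still to be read, deque content listed from front
to tail. -/
structure Config (α Γ Q : Type) where
  state : Q
  input : List α
  deque : List Γ

namespace Automaton

variable {α Γ Q : Type}

/-- The move relation:
`(q, a u, γ_l γ γ_r) → (q', u, σ γ ρ)` for each transition `(q, a, γ_l, γ_r, q', σ, ρ)`. -/
def Move (M : Automaton α Γ Q) (c c' : Config α Γ Q) : Prop :=
  ∃ t ∈ M.trans, ∃ (u : List α) (γ : List Γ),
    c = ⟨t.src, t.input.toList ++ u, t.readFront ++ γ ++ t.readTail⟩ ∧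
    c' = ⟨t.dst, u, t.writeFront ++ γ ++ t.writeTail⟩

/-- `M.Moves n c c'`: there is a sequence of exactly `n` moves from `c` to `c'`. -/
def Moves (M : Automaton α Γ Q) : ℕ → Config α Γ Q → Config α Γ Q → Prop
  | 0, c, c' => c = c'
  | n + 1, c, c' => ∃ d, M.Move c d ∧ M.Moves n d c'

/-- The initial configuration on input `w`; the deque is empty. -/
def initial (M : Automaton α Γ Q) (w : List α) : Config α Γ Q := ⟨M.start, w, []⟩

/-- Quasi-real-time operation with delay `p`: in every computation, on any input, each sequence
of `p` consecutive moves advances the input head by at least one position. -/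
def QuasiRealTimeWith (M : Automaton α Γ Q) (p : ℕ) : Prop :=
  ∀ (w : List α) (n : ℕ) (c c' : Config α Γ Q),
    M.Moves n (M.initial w) c → M.Moves p c c' → c'.input.length < c.input.length

/-- Quasi-real-time operation with some constant delay `p ≥ 1`. -/
def QuasiRealTime (M : Automaton α Γ Q) : Prop :=
  ∃ p : ℕ, 1 ≤ p ∧ M.QuasiRealTimeWith p

/-- The language of `M`: acceptance by final state with the input read completely and the
deque empty. -/
def language (M : Automaton α Γ Q) : Language α :=
  {w | ∃ (n : ℕ) (q : Q), q ∈ M.final ∧ M.Moves n (M.initial w) ⟨q, [], []⟩}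

end Automaton

/-- A family of languages, each of which is over a finite alphabet. -/
abbrev LanguageFamily : Type 1 := ∀ (α : Type) [Finite α], Set (Language α)

/-- The family of deque languages: those accepted by quasi-real-time deque automata with finitely
many deque symbols and states. -/
def dequeLanguages : LanguageFamily := fun α _ =>
  {L | ∃ (Γ Q : Type) (_ : Finite Γ) (_ : Finite Q) (M : Automaton α Γ Q),
    M.QuasiRealTime ∧ M.language = L}

section Operations

variable {α β : Type}

/-- The extension of a letter map `h : α → β*` to the monoid homomorphism `α* → β*`. -/
def wordHom (h : α → List β) (w : List α) : List β := w.flatMap h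

/-- `h` is nonerasing (`ε`-free): no letter is mapped to the empty word. -/
def Nonerasing (h : α → List β) : Prop := ∀ a, h a ≠ []

/-- The homomorphic image `h(L)`. -/
def homImage (h : α → List β) (L : Language α) : Language β := {w | ∃ v ∈ L, wordHom h v = w}

/-- The inverse homomorphic image `g⁻¹(L)`. -/
def homPreimage (g : α → List β) (L : Language β) : Language α := {v | wordHom g v ∈ L}

end Operations

def ClosedUnderUnion (F : LanguageFamily) : Prop :=
  ∀ (α : Type) [Finite α] (L₁ L₂ : Language α), L₁ ∈ F α → L₂ ∈ F α → L₁ + L₂ ∈ F α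

def ClosedUnderConcatenation (F : LanguageFamily) : Prop :=
  ∀ (α : Type) [Finite α] (L₁ L₂ : Language α), L₁ ∈ F α → L₂ ∈ F α → L₁ * L₂ ∈ F α

/-- Closure under `L ↦ L⁺ = L L*`. -/
def ClosedUnderKleenePlus (F : LanguageFamily) : Prop :=
  ∀ (α : Type) [Finite α] (L : Language α), L ∈ F α → L * L∗ ∈ F α

def ClosedUnderKleeneStar (F : LanguageFamily) : Prop :=
  ∀ (α : Type) [Finite α] (L : Language α), L ∈ F α → L∗ ∈ F α

def ClosedUnderRegularIntersection (F : LanguageFamily) : Prop :=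
  ∀ (α : Type) [Finite α] (L R : Language α), L ∈ F α → R.IsRegular → L ⊓ R ∈ F α

def ClosedUnderNonerasingHom (F : LanguageFamily) : Prop :=
  ∀ (α β : Type) [Finite α] [Finite β] (h : α → List β) (L : Language α),
    Nonerasing h → L ∈ F α → homImage h L ∈ F β

/-- Closure under arbitrary, possibly erasing, homomorphisms. -/
def ClosedUnderHom (F : LanguageFamily) : Prop :=
  ∀ (α β : Type) [Finite α] [Finite β] (h : α → List β) (L : Language α),
    L ∈ F α → homImage h L ∈ F β

/-- Closure under inverses of arbitrary, possibly erasing, homomorphisms. -/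
def ClosedUnderInverseHom (F : LanguageFamily) : Prop :=
  ∀ (α β : Type) [Finite α] [Finite β] (g : α → List β) (L : Language β),
    L ∈ F β → homPreimage g L ∈ F α

/-- An abstract family of languages (AFL): it contains a nonempty language and is closed under
the six AFL operations. Languages over different alphabets are compared inside a common larger
alphabet; renaming of letters is a nonerasing homomorphism. -/
structure IsAFL (F : LanguageFamily) : Prop where
  nontrivial : ∃ (α : Type) (_ : Finite α), ∃ L ∈ F α, (L : Set (List α)).Nonempty
  union : ClosedUnderUnion F
  concatenation : ClosedUnderConcatenation F
  kleenePlus : ClosedUnderKleenePlus F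
  regularIntersection : ClosedUnderRegularIntersection F
  nonerasingHom : ClosedUnderNonerasingHom F
  inverseHom : ClosedUnderInverseHom F

/-- A full AFL is an AFL that is closed under arbitrary homomorphisms. -/
structure IsFullAFL (F : LanguageFamily) : Prop extends IsAFL F where
  hom : ClosedUnderHom F

end DequeAFL

/-!
The closure properties are proved on `RankedAutomaton`s. These may jump silently between states when
the deque is empty, and they carry a rank on the states that every silent move lowers, so that
quasi-real-time operation is a local condition on the transitions instead of a property of all
computations. By `mem_dequeLanguages_iff` they accept exactly the deque languages: a counter in the
state that counts the silent moves down to the next letter is a rank, and conversely a marker at the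
tail of the deque makes the test for emptiness possible. With jumps available, union and
concatenation are disjoint sums, and Kleene plus goes back from a final state to a start state. There
a run that has read nothing may not go back, since this would create silent cycles; no word of `L⁺`
is lost. Products with deterministic finite automata, and buffers in the state for the unread rest of
an image word, give the other closure properties.

Erasing homomorphisms lead out of the family because they hide unbounded computations. A deque is a
circular tape with a marker between its two ends, so a deque automaton that reads one padding letter
with every move simulates a Turing machine in real time (`homImage_simulation_language`), and erasing
the padding leaves the set of the words on which the machine halts. If the family were closed under
homomorphisms, all these sets would be deque languages. But deque languages are decidable, since a
quasi-real-time automaton makes only linearly many moves (`computablePred_of_mem_dequeLanguages`),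
whereas Mathlib's chain of reductions from partial recursive functions to one-tape machines yields a
machine with an undecidable halting set (`exists_turingMachine_not_computablePred`).
-/

open scoped Computability

namespace DequeAFL

/-! ### Labelled runs -/

/-- Runs of a labelled transition system `S`, where the label `none` marks a silent step: the word of
`Run S c w d` is the sequence of letters read on the way from `c` to `d`. -/
inductive Run {C α : Type} (S : C → Option α → C → Prop) : C → List α → C → Prop
  | refl (c : C) : Run S c [] c
  | head {c d e : C} {o : Option α} {w : List α} :
      S c o d → Run S d w e → Run S c (o.toList ++ w) e

namespace Run

variable {C D α : Type} {S : C → Option α → C → Prop}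

theorem trans {c d e : C} {v w : List α} (h : Run S c v d) (h' : Run S d w e) :
    Run S c (v ++ w) e := by
  induction h with
  | refl => exact h'
  | head hs _ ih => rw [List.append_assoc]; exact head hs (ih h')

theorem silent {c d e : C} {w : List α} (h : S c none d) (h' : Run S d w e) : Run S c w e :=
  head h h'

theorem letter {c d e : C} {a : α} {w : List α} (h : S c (some a) d) (h' : Run S d w e) :
    Run S c (a :: w) e :=
  head h h'

theorem map {T : D → Option α → D → Prop} (f : C → D)
    (hf : ∀ c o d, S c o d → T (f c) o (f d)) {c d : C} {w : List α} (h : Run S c w d) :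
    Run T (f c) w (f d) := by
  induction h with
  | refl => exact refl _
  | head hs _ ih => exact head (hf _ _ _ hs) ih

end Run

/-! ### Ranked automata -/

/-- A transition, transported along maps of the deque symbols and of the states. -/
def Transition.map {α Γ Γ' Q Q' : Type} (f : Γ → Γ') (g : Q → Q') (t : Transition α Γ Q) :
    Transition α Γ' Q' :=
  ⟨g t.src, t.input, t.readFront.map f, t.readTail.map f, g t.dst, t.writeFront.map f,
    t.writeTail.map f⟩

/-- The effect of the transition `t` on pairs of a state and a deque content. -/
def Transition.Fires {α Γ Q : Type} (t : Transition α Γ Q) (c : Q × List Γ) (o : Option α)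
    (d : Q × List Γ) : Prop :=
  ∃ y, c = (t.src, t.readFront ++ y ++ t.readTail) ∧ o = t.input ∧
    d = (t.dst, t.writeFront ++ y ++ t.writeTail)

/-- The labelled steps of a deque automaton. -/
def Automaton.Step {α Γ Q : Type} (M : Automaton α Γ Q) (c : Q × List Γ) (o : Option α)
    (d : Q × List Γ) : Prop :=
  ∃ t ∈ M.trans, t.Fires c o d

theorem Transition.Fires.map {α Γ Γ' Q Q' : Type} {t : Transition α Γ Q} {c d : Q × List Γ}
    {o : Option α} (h : t.Fires c o d) (f : Γ → Γ') (g : Q → Q') :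
    (t.map f g).Fires (g c.1, c.2.map f) o (g d.1, d.2.map f) := by
  obtain ⟨y, rfl, rfl, rfl⟩ := h
  exact ⟨y.map f, by simp [Transition.map], rfl, by simp [Transition.map]⟩

/-- A deque automaton with several start states, with silent jumps that test the deque for
emptiness, and with a rank on the states that every silent move lowers. Over a finite state set the
rank bounds the number of consecutive silent moves of every run, so quasi-real-time operation is
built in. -/
structure RankedAutomaton (α Γ Q : Type) where
  /-- the start states -/
  start : Set Q
  /-- the final states -/
  final : Set Q
  /-- the transitions -/
  trans : Set (Transition α Γ Q)
  /-- the silent moves that are possible on the empty deque only -/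
  jump : Q → Q → Prop
  /-- the rank of a state -/
  rank : Q → ℕ
  trans_finite : trans.Finite
  rank_trans : ∀ t ∈ trans, t.input = none → rank t.dst < rank t.src
  rank_jump : ∀ p q, jump p q → rank q < rank p

namespace RankedAutomaton

variable {α Γ Q : Type}

/-- The labelled steps of a ranked automaton. -/
def Step (G : RankedAutomaton α Γ Q) (c : Q × List Γ) (o : Option α) (d : Q × List Γ) : Prop :=
  (∃ t ∈ G.trans, t.Fires c o d) ∨ (o = none ∧ G.jump c.1 d.1 ∧ c.2 = [] ∧ d.2 = [])

/-- The words read on a run that leads from a start state to a final state, with the empty deque at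
both ends. -/
def language (G : RankedAutomaton α Γ Q) : Language α :=
  {w | ∃ s ∈ G.start, ∃ f ∈ G.final, Run G.Step (s, []) w (f, [])}

theorem exists_rank_le (G : RankedAutomaton α Γ Q) [Finite Q] : ∃ B, ∀ q, G.rank q ≤ B := by
  obtain ⟨B, hB⟩ := (Set.finite_range G.rank).bddAbove
  exact ⟨B, fun q => hB ⟨q, rfl⟩⟩

end RankedAutomaton

namespace Automaton

variable {α Γ Q : Type}

theorem move_iff (M : Automaton α Γ Q) (c c' : Config α Γ Q) :
    M.Move c c' ↔
      ∃ o, M.Step (c.state, c.deque) o (c'.state, c'.deque) ∧ c.input = o.toList ++ c'.input := by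
  constructor
  · rintro ⟨t, ht, u, y, rfl, rfl⟩
    exact ⟨t.input, ⟨t, ht, y, rfl, rfl, rfl⟩, rfl⟩
  · rintro ⟨o, ⟨t, ht, y, h₁, rfl, h₂⟩, h₃⟩
    obtain ⟨q, u, x⟩ := c
    obtain ⟨q', u', x'⟩ := c'
    simp only [Prod.mk.injEq] at h₁ h₂ h₃
    obtain ⟨rfl, rfl⟩ := h₁
    obtain ⟨rfl, rfl⟩ := h₂
    subst h₃
    exact ⟨t, ht, u', y, rfl, rfl⟩

theorem moves_add (M : Automaton α Γ Q) {a b : ℕ} {c e : Config α Γ Q} :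
    M.Moves (a + b) c e ↔ ∃ d, M.Moves a c d ∧ M.Moves b d e := by
  induction a generalizing c with
  | zero => simp [Moves]
  | succ a ih =>
    rw [Nat.succ_add]
    simp only [Moves, ih]
    constructor
    · rintro ⟨d, hd, d', h₁, h₂⟩
      exact ⟨d', ⟨d, hd, h₁⟩, h₂⟩
    · rintro ⟨d', ⟨d, hd, h₁⟩, h₂⟩
      exact ⟨d, hd, d', h₁, h₂⟩

theorem exists_moves_iff (M : Automaton α Γ Q) (c c' : Config α Γ Q) :
    (∃ n, M.Moves n c c') ↔
      ∃ w, c.input = w ++ c'.input ∧ Run M.Step (c.state, c.deque) w (c'.state, c'.deque) := by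
  constructor
  · rintro ⟨n, h⟩
    induction n generalizing c with
    | zero => cases h; exact ⟨[], rfl, .refl _⟩
    | succ n ih =>
      obtain ⟨d, hd, h⟩ := h
      obtain ⟨w, hw, hr⟩ := ih d h
      obtain ⟨o, hs, ho⟩ := (M.move_iff c d).1 hd
      exact ⟨o.toList ++ w, by rw [ho, hw, List.append_assoc], .head hs hr⟩
  · rintro ⟨w, hw, hr⟩
    obtain ⟨q, u, x⟩ := c
    obtain ⟨q', u', x'⟩ := c'
    simp only at hw hr
    subst hw
    generalize hc : (q, x) = c at hr
    generalize hd : (q', x') = d at hr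
    induction hr generalizing q x with
    | refl c => subst hc; cases hd; exact ⟨0, rfl⟩
    | @head c d' e o w hs _ ih =>
      obtain ⟨n, hn⟩ := ih d'.1 d'.2 rfl hd
      refine ⟨n + 1, ⟨d'.1, w ++ u', d'.2⟩, ?_, hn⟩
      subst hc
      exact (M.move_iff _ _).2 ⟨o, hs, by simp⟩

theorem mem_language_iff (M : Automaton α Γ Q) (w : List α) :
    w ∈ M.language ↔ ∃ q ∈ M.final, Run M.Step (M.start, []) w (q, []) := by
  have key : ∀ q : Q, (∃ n, M.Moves n (M.initial w) ⟨q, [], []⟩) ↔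
      Run M.Step (M.start, []) w (q, []) := by
    intro q
    rw [exists_moves_iff]
    simp [initial]
  constructor
  · rintro ⟨n, q, hq, h⟩
    exact ⟨q, hq, (key q).1 ⟨n, h⟩⟩
  · rintro ⟨q, hq, h⟩
    obtain ⟨n, hn⟩ := (key q).2 h
    exact ⟨n, q, hq, hn⟩

/-- A bounded rank that every silent transition lowers forces quasi-real-time operation. -/
theorem quasiRealTime_of_rank (M : Automaton α Γ Q) (rank : Q → ℕ) (B : ℕ)
    (hB : ∀ q, rank q ≤ B)
    (h : ∀ t ∈ M.trans, t.input = none → rank t.dst < rank t.src) : M.QuasiRealTime := by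
  have key : ∀ n (c c' : Config α Γ Q), M.Moves n c c' →
      c'.input.length ≤ c.input.length ∧
        (c'.input.length = c.input.length → rank c'.state + n ≤ rank c.state) := by
    intro n
    induction n with
    | zero => rintro c _ rfl; simp
    | succ n ih =>
      rintro c c' ⟨d, ⟨t, ht, u, y, rfl, rfl⟩, hm⟩
      obtain ⟨h₁, h₂⟩ := ih _ _ hm
      cases ho : t.input with
      | none =>
        have := h t ht ho
        simp only [Option.toList_none, List.nil_append] at h₁ h₂ ⊢
        exact ⟨h₁, fun e => by have := h₂ e; omega⟩
      | some a =>
        simp only [Option.toList_some, List.cons_append, List.nil_append,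
          List.length_cons] at h₁ h₂ ⊢
        exact ⟨by omega, fun e => by omega⟩
  refine ⟨B + 1, by omega, fun w n c c' _ hm => ?_⟩
  obtain ⟨h₁, h₂⟩ := key _ _ _ hm
  by_contra hc
  have := h₂ (by omega)
  have := hB c.state
  omega

end Automaton

namespace RankedAutomaton

variable {α Γ Q : Type}

/-- The transitions of `toAutomaton`. -/
inductive MarkedTransition (G : RankedAutomaton α Γ Q) :
    Transition α (Option Γ) (Option (Option Q)) → Prop
  | start (s : Q) : s ∈ G.start →
      MarkedTransition G ⟨none, none, [], [], some (some s), [none], []⟩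
  | trans (t : Transition α Γ Q) : t ∈ G.trans →
      MarkedTransition G ⟨some (some t.src), t.input, t.readFront.map some,
        t.readTail.map some ++ [none], some (some t.dst), t.writeFront.map some,
        t.writeTail.map some ++ [none]⟩
  | jump (p q : Q) : G.jump p q →
      MarkedTransition G ⟨some (some p), none, [none], [], some (some q), [none], []⟩
  | final (f : Q) : f ∈ G.final →
      MarkedTransition G ⟨some (some f), none, [none], [], some none, [], []⟩

/-- The deque automaton that keeps the extra symbol `none` at the tail of the deque of `G`. The deque
of `G` is empty when the marker `none` can be removed at the front. The states `none` and
`some none` are the new start state and the new final state. -/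
def toAutomaton [Finite Q] (G : RankedAutomaton α Γ Q) :
    Automaton α (Option Γ) (Option (Option Q)) where
  start := none
  final := {some none}
  trans := {t | MarkedTransition G t}
  trans_finite := by
    have h₁ := Set.toFinite (Set.range fun s : Q =>
      (⟨none, none, [], [], some (some s), [none], []⟩ :
        Transition α (Option Γ) (Option (Option Q))))
    have h₂ := G.trans_finite.image fun t : Transition α Γ Q =>
      (⟨some (some t.src), t.input, t.readFront.map some,
        t.readTail.map some ++ [none], some (some t.dst), t.writeFront.map some,
        t.writeTail.map some ++ [none]⟩ : Transition α (Option Γ) (Option (Option Q)))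
    have h₃ := Set.toFinite (Set.range fun s : Q × Q =>
      (⟨some (some s.1), none, [none], [], some (some s.2), [none], []⟩ :
        Transition α (Option Γ) (Option (Option Q))))
    have h₄ := Set.toFinite (Set.range fun s : Q =>
      (⟨some (some s), none, [none], [], some none, [], []⟩ :
        Transition α (Option Γ) (Option (Option Q))))
    refine (((h₁.union h₂).union h₃).union h₄).subset ?_
    rintro t (⟨s, hs⟩ | ⟨t, ht⟩ | ⟨p, q, hpq⟩ | ⟨f, hf⟩)
    · exact .inl (.inl (.inl ⟨s, rfl⟩))
    · exact .inl (.inl (.inr ⟨t, ht, rfl⟩))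
    · exact .inl (.inr ⟨(p, q), rfl⟩)
    · exact .inr ⟨f, rfl⟩

theorem toAutomaton_quasiRealTime [Finite Q] (G : RankedAutomaton α Γ Q) :
    G.toAutomaton.QuasiRealTime := by
  obtain ⟨B, hB⟩ := G.exists_rank_le
  refine G.toAutomaton.quasiRealTime_of_rank
    (fun q => match q with
      | none => B + 2
      | some none => 0
      | some (some q) => G.rank q + 1) (B + 2) ?_ ?_
  · rintro (_ | _ | q)
    · exact le_rfl
    · exact Nat.zero_le _
    · have := hB q
      simp only
      omega
  · rintro t (⟨s, hs⟩ | ⟨t, ht⟩ | ⟨p, q, hpq⟩ | ⟨f, hf⟩) ho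
    · have := hB s
      simp only
      omega
    · have := G.rank_trans t ht ho
      simp only
      omega
    · have := G.rank_jump p q hpq
      simp only
      omega
    · simp only
      omega

theorem marked_eq_append {x : List Γ} {l r : List Γ} {y : List (Option Γ)}
    (h : x.map some ++ [none] = l.map some ++ y ++ (r.map some ++ [none])) :
    ∃ z : List Γ, y = z.map some ∧ x = l ++ z ++ r := by
  rw [← List.append_assoc, List.append_left_inj] at h
  obtain ⟨xl, xr, rfl, h₁, h₂⟩ := List.map_eq_append_iff.1 h
  obtain ⟨a, z, rfl, h₃, h₄⟩ := List.map_eq_append_iff.1 h₁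
  have hinj : Function.Injective (List.map (some : Γ → Option Γ)) :=
    List.map_injective_iff.2 (Option.some_injective Γ)
  exact ⟨z, h₄.symm, by rw [hinj h₃, hinj h₂]⟩

theorem marked_eq_cons {x : List Γ} {y : List (Option Γ)}
    (h : x.map some ++ [none] = [none] ++ y ++ []) : x = [] ∧ y = [] := by
  cases x with
  | nil => simpa using h.symm
  | cons a x => simp at h

theorem toAutomaton_language [Finite Q] (G : RankedAutomaton α Γ Q) :
    G.toAutomaton.language = G.language := by
  ext w
  rw [Automaton.mem_language_iff]
  constructor
  · rintro ⟨_, rfl, h⟩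
    have key : ∀ (c d : Option (Option Q) × List (Option Γ)) (w : List α),
        Run G.toAutomaton.Step c w d → d = (some none, []) →
        ∀ q x, c = (some (some q), x.map some ++ [none]) →
          ∃ f ∈ G.final, Run G.Step (q, x) w (f, []) := by
      intro c d w h hd
      induction h with
      | refl => rintro q x rfl; cases hd
      | @head c d e o w hs hr ih =>
        rintro q x rfl
        obtain ⟨t, ht, y, h₁, rfl, h₃⟩ := hs
        cases ht with
        | start => cases h₁
        | trans t ht =>
          simp only [Prod.mk.injEq, Option.some.injEq] at h₁
          obtain ⟨rfl, h₁⟩ := h₁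
          obtain ⟨z, rfl, rfl⟩ := marked_eq_append h₁
          obtain ⟨f, hf, hr'⟩ := ih hd t.dst (t.writeFront ++ z ++ t.writeTail)
            (by rw [h₃]; simp)
          exact ⟨f, hf, .head (.inl ⟨t, ht, z, rfl, rfl, rfl⟩) hr'⟩
        | jump p q hpq =>
          simp only [Prod.mk.injEq, Option.some.injEq] at h₁
          obtain ⟨rfl, h₁⟩ := h₁
          obtain ⟨rfl, rfl⟩ := marked_eq_cons h₁
          obtain ⟨f, hf, hr'⟩ := ih hd q [] (by rw [h₃]; simp)
          exact ⟨f, hf, .silent (.inr ⟨rfl, hpq, rfl, rfl⟩) hr'⟩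
        | final f hf =>
          simp only [Prod.mk.injEq, Option.some.injEq] at h₁
          obtain ⟨rfl, h₁⟩ := h₁
          obtain ⟨rfl, rfl⟩ := marked_eq_cons h₁
          refine ⟨q, hf, ?_⟩
          cases hr with
          | refl => exact .refl _
          | head hs _ =>
            obtain ⟨t, ht, y, h₁, rfl, h₃'⟩ := hs
            subst h₃
            cases ht <;> cases h₁
    change Run _ (none, []) w _ at h
    generalize hc : ((none : Option (Option Q)), ([] : List (Option Γ))) = c at h
    cases h with
    | refl => cases hc
    | head hs hr =>
      obtain ⟨t, ht, y, h₁, rfl, h₃⟩ := hs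
      subst hc
      cases ht with
      | start s hs =>
        simp only [Prod.mk.injEq, true_and, List.nil_append, List.append_nil] at h₁
        subst h₁
        obtain ⟨f, hf, hr'⟩ := key _ _ _ hr rfl s [] (by rw [h₃]; simp)
        exact ⟨s, hs, f, hf, hr'⟩
      | trans => cases h₁
      | jump => cases h₁
      | final => cases h₁
  · rintro ⟨s, hs, f, hf, hr⟩
    refine ⟨_, rfl, ?_⟩
    refine .silent (d := (some (some s), [none]))
      ⟨_, .start s hs, [], rfl, rfl, rfl⟩ ?_
    rw [← List.append_nil w]
    refine Run.trans (d := (some (some f), [none])) ?_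
      (.silent ⟨_, .final f hf, [], rfl, rfl, rfl⟩ (.refl _))
    refine hr.map (T := G.toAutomaton.Step)
      (fun c => (some (some c.1), c.2.map some ++ [none])) ?_
    rintro ⟨p, x⟩ o ⟨q, x'⟩ (⟨t, ht, y, h₁, rfl, h₃⟩ | ⟨rfl, hj, hx, hx'⟩)
    · simp only [Prod.mk.injEq] at h₁ h₃
      obtain ⟨rfl, rfl⟩ := h₁
      obtain ⟨rfl, rfl⟩ := h₃
      exact ⟨_, .trans t ht, y.map some, by simp, rfl, by simp⟩
    · simp only at hx hx' hj
      subst hx hx'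
      exact ⟨_, .jump p q hj, [], rfl, rfl, rfl⟩

end RankedAutomaton

namespace Automaton

variable {α Γ Q : Type}

/-- `M` with a counter in the state that counts the silent moves down to the next letter or to the end
of the run. -/
def withCountdown (M : Automaton α Γ Q) (p : ℕ) : RankedAutomaton α Γ (Q × Fin p) where
  start := {s | s.1 = M.start}
  final := {s | s.1 ∈ M.final}
  trans := {t' | ∃ t ∈ M.trans, ∃ k k' : Fin p, (t.input = none → k' < k) ∧
    t' = { t with src := (t.src, k), dst := (t.dst, k') }}
  jump _ _ := False
  rank s := s.2
  trans_finite := by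
    refine ((M.trans_finite.prod (Set.toFinite (Set.univ : Set (Fin p × Fin p)))).image
      fun x => ({ x.1 with src := (x.1.src, x.2.1), dst := (x.1.dst, x.2.2) } :
        Transition α Γ (Q × Fin p))).subset ?_
    rintro _ ⟨t, ht, k, k', _, rfl⟩
    exact ⟨(t, k, k'), ⟨ht, trivial⟩, rfl⟩
  rank_trans := by
    rintro _ ⟨t, ht, k, k', h, rfl⟩ ho
    exact h ho
  rank_jump _ _ h := h.elim

/-- Fewer than `p` consecutive moves of a computation read nothing. -/
theorem QuasiRealTimeWith.lt_of_moves {M : Automaton α Γ Q} {p : ℕ} (h : M.QuasiRealTimeWith p)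
    {w : List α} {n k : ℕ} {c c' : Config α Γ Q} (hn : M.Moves n (M.initial w) c)
    (hk : M.Moves k c c') (he : c'.input = c.input) : k < p := by
  by_contra hlt
  obtain ⟨r, rfl⟩ := Nat.exists_eq_add_of_le (not_lt.1 hlt)
  obtain ⟨d, h₁, h₂⟩ := M.moves_add.1 hk
  have h₃ := h w n c d hn h₁
  obtain ⟨v, hv, -⟩ := (M.exists_moves_iff d c').1 ⟨_, h₂⟩
  have := congrArg List.length hv
  rw [he] at this
  simp at this
  omega

theorem withCountdown_language (M : Automaton α Γ Q) {p : ℕ} (hp : M.QuasiRealTimeWith p) :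
    (M.withCountdown p).language = M.language := by
  ext w
  rw [mem_language_iff]
  constructor
  · rintro ⟨⟨s, k⟩, hs, ⟨f, k'⟩, hf, h⟩
    change s = M.start at hs
    subst hs
    refine ⟨f, hf, ?_⟩
    refine h.map (T := M.Step) (fun c => (c.1.1, c.2)) ?_
    rintro _ o _ (⟨_, ⟨t, ht, k, k', _, rfl⟩, y, rfl, rfl, rfl⟩ | ⟨_, h, _⟩)
    · exact ⟨t, ht, y, rfl, rfl, rfl⟩
    · exact h.elim
  · rintro ⟨f, hf, h⟩
    -- the first counter value is the number of silent moves before the first letter of `v`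
    have key : ∀ (c d : Q × List Γ) (v : List α), Run M.Step c v d →
        ∀ n, M.Moves n (M.initial w) ⟨c.1, v, c.2⟩ →
        ∃ k k' : Fin p, Run (M.withCountdown p).Step ((c.1, k), c.2) v ((d.1, k'), d.2) ∧
          ∃ c' : Config α Γ Q, M.Moves k ⟨c.1, v, c.2⟩ c' ∧ c'.input = v := by
      intro c d v h
      induction h with
      | refl c =>
        intro n hn
        have hp := hp.lt_of_moves (k := 0) hn rfl rfl
        exact ⟨⟨0, hp⟩, ⟨0, hp⟩, .refl _, _, rfl, rfl⟩
      | @head c d e o v hs hr ih =>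
        intro n hn
        have hm : M.Move ⟨c.1, o.toList ++ v, c.2⟩ ⟨d.1, v, d.2⟩ :=
          (M.move_iff _ _).2 ⟨o, hs, rfl⟩
        obtain ⟨k, k', hk, c', hc, hv⟩ := ih (n + 1) (M.moves_add.2 ⟨_, hn, _, hm, rfl⟩)
        obtain ⟨t, ht, y, rfl, rfl, rfl⟩ := hs
        cases ho : t.input with
        | none =>
          rw [ho] at hn hm
          have hm' : M.Moves (k + 1) ⟨t.src, v, t.readFront ++ y ++ t.readTail⟩ c' :=
            ⟨_, hm, hc⟩
          have hlt := hp.lt_of_moves hn hm' hv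
          refine ⟨⟨k + 1, hlt⟩, k', .silent (.inl ⟨_, ⟨t, ht, ⟨k + 1, hlt⟩, k, ?_, rfl⟩, y, rfl,
            ho.symm, rfl⟩) hk, c', hm', hv⟩
          intro _
          exact Nat.lt_succ_self _
        | some a =>
          have h0 : 0 < p := k.pos
          refine ⟨⟨0, h0⟩, k', .letter (.inl ⟨_, ⟨t, ht, ⟨0, h0⟩, k, ?_, rfl⟩, y, rfl,
            ho.symm, rfl⟩) hk, _, rfl, rfl⟩
          intro h
          rw [ho] at h
          cases h
    obtain ⟨k, k', hk, -⟩ := key _ _ _ h 0 rfl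
    exact ⟨(M.start, k), rfl, (f, k'), hf, hk⟩

end Automaton

/-- The deque languages are the languages of finite ranked automata. -/
theorem mem_dequeLanguages_iff {α : Type} [Finite α] {L : Language α} :
    L ∈ dequeLanguages α ↔ ∃ (Γ Q : Type) (_ : Finite Γ) (_ : Finite Q)
      (G : RankedAutomaton α Γ Q), G.language = L := by
  constructor
  · rintro ⟨Γ, Q, hΓ, hQ, M, ⟨p, _, hp⟩, rfl⟩
    exact ⟨Γ, Q × Fin p, hΓ, inferInstance, M.withCountdown p, M.withCountdown_language hp⟩
  · rintro ⟨Γ, Q, hΓ, hQ, G, rfl⟩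
    exact ⟨Option Γ, Option (Option Q), inferInstance, inferInstance, G.toAutomaton,
      G.toAutomaton_quasiRealTime, G.toAutomaton_language⟩

/-! ### Union and concatenation -/

theorem Transition.Fires.of_map {α Γ Γ' Q Q' : Type} {t : Transition α Γ Q} {f : Γ → Γ'}
    {g : Q → Q'} (hf : Function.Injective f) {q : Q'} {x : List Γ} {o : Option α}
    {d : Q' × List Γ'} (h : (t.map f g).Fires (q, x.map f) o d) :
    q = g t.src ∧ ∃ x', t.Fires (t.src, x) o (t.dst, x') ∧ d = (g t.dst, x'.map f) := by
  obtain ⟨y, h₁, rfl, rfl⟩ := h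
  simp only [Prod.mk.injEq, Transition.map] at h₁
  obtain ⟨rfl, h₁⟩ := h₁
  obtain ⟨xl, xr, rfl, h₁, h₂⟩ := List.map_eq_append_iff.1 h₁
  obtain ⟨a, z, rfl, h₃, rfl⟩ := List.map_eq_append_iff.1 h₁
  have hinj : Function.Injective (List.map f) := List.map_injective_iff.2 hf
  rw [hinj h₃, hinj h₂]
  exact ⟨rfl, _, ⟨z, rfl, rfl, rfl⟩, by simp [Transition.map]⟩

namespace RankedAutomaton

variable {α Γ Γ₁ Γ₂ Q Q₁ Q₂ : Type}

/-- The disjoint sum of two ranked automata, with additional silent jumps from states of the first to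
states of the second. The first summand is ranked above the second. -/
noncomputable def sum [Finite Q₂] (G₁ : RankedAutomaton α Γ₁ Q₁) (G₂ : RankedAutomaton α Γ₂ Q₂)
    (bridge : Q₁ → Q₂ → Prop) (start final : Set (Q₁ ⊕ Q₂)) :
    RankedAutomaton α (Γ₁ ⊕ Γ₂) (Q₁ ⊕ Q₂) where
  start := start
  final := final
  trans := Transition.map .inl .inl '' G₁.trans ∪ Transition.map .inr .inr '' G₂.trans
  jump
    | .inl p, .inl q => G₁.jump p q
    | .inl p, .inr q => bridge p q
    | .inr _, .inl _ => False
    | .inr p, .inr q => G₂.jump p q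
  rank
    | .inl q => G₁.rank q + G₂.exists_rank_le.choose + 1
    | .inr q => G₂.rank q
  trans_finite := (G₁.trans_finite.image _).union (G₂.trans_finite.image _)
  rank_trans := by
    rintro _ (⟨t, ht, rfl⟩ | ⟨t, ht, rfl⟩) ho
    · have := G₁.rank_trans t ht ho
      simp only [Transition.map]
      omega
    · exact G₂.rank_trans t ht ho
  rank_jump := by
    rintro (p | p) (q | q) h
    · have := G₁.rank_jump p q h
      simp only
      omega
    · have := G₂.exists_rank_le.choose_spec q
      simp only
      omega
    · exact h.elim
    · exact G₂.rank_jump p q h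

section Sum

variable [Finite Q₂] {G₁ : RankedAutomaton α Γ₁ Q₁} {G₂ : RankedAutomaton α Γ₂ Q₂}
  {bridge : Q₁ → Q₂ → Prop} {start final : Set (Q₁ ⊕ Q₂)}

theorem sum_run_inl {c d : Q₁ × List Γ₁} {w : List α} (h : Run G₁.Step c w d) :
    Run (G₁.sum G₂ bridge start final).Step (.inl c.1, c.2.map .inl) w
      (.inl d.1, d.2.map .inl) := by
  refine h.map (fun c => (Sum.inl c.1, c.2.map Sum.inl)) ?_
  rintro c o d (⟨t, ht, h⟩ | ⟨rfl, hj, hx, hx'⟩)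
  · exact .inl ⟨_, .inl ⟨t, ht, rfl⟩, h.map _ _⟩
  · exact .inr ⟨rfl, hj, by simp [hx], by simp [hx']⟩

theorem sum_run_inr {c d : Q₂ × List Γ₂} {w : List α} (h : Run G₂.Step c w d) :
    Run (G₁.sum G₂ bridge start final).Step (.inr c.1, c.2.map .inr) w
      (.inr d.1, d.2.map .inr) := by
  refine h.map (fun c => (Sum.inr c.1, c.2.map Sum.inr)) ?_
  rintro c o d (⟨t, ht, h⟩ | ⟨rfl, hj, hx, hx'⟩)
  · exact .inl ⟨_, .inr ⟨t, ht, rfl⟩, h.map _ _⟩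
  · exact .inr ⟨rfl, hj, by simp [hx], by simp [hx']⟩

theorem exists_of_sum_run_inr {c d : (Q₁ ⊕ Q₂) × List (Γ₁ ⊕ Γ₂)} {w : List α}
    (h : Run (G₁.sum G₂ bridge start final).Step c w d) {q : Q₂} {x : List Γ₂}
    (hc : c = (.inr q, x.map .inr)) :
    ∃ q' x', d = (.inr q', x'.map .inr) ∧ Run G₂.Step (q, x) w (q', x') := by
  induction h generalizing q x with
  | refl => exact ⟨q, x, hc, .refl _⟩
  | @head c d e o w hs hr ih =>
    subst hc
    rcases hs with ⟨_, ⟨t, ht, rfl⟩ | ⟨t, ht, rfl⟩, h⟩ | ⟨rfl, hj, hx, hx'⟩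
    · obtain ⟨y, h, -⟩ := h
      cases h
    · obtain ⟨hq, x', hf, rfl⟩ := h.of_map Sum.inr_injective
      cases hq
      obtain ⟨q', x'', he, hr'⟩ := ih rfl
      exact ⟨q', x'', he, .head (.inl ⟨t, ht, hf⟩) hr'⟩
    · obtain ⟨q' | q', x'⟩ := d
      · exact hj.elim
      · obtain rfl : x' = [] := hx'
        obtain rfl : x = [] := by simpa using hx
        obtain ⟨q'', x'', he, hr'⟩ := ih (q := q') (x := []) rfl
        exact ⟨q'', x'', he, .silent (d := (q', [])) (.inr ⟨rfl, hj, rfl, rfl⟩) hr'⟩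

/-- A run of the sum that starts in the first summand stays there or crosses one bridge. -/
theorem exists_of_sum_run_inl {c d : (Q₁ ⊕ Q₂) × List (Γ₁ ⊕ Γ₂)} {w : List α}
    (h : Run (G₁.sum G₂ bridge start final).Step c w d) {q : Q₁} {x : List Γ₁}
    (hc : c = (.inl q, x.map .inl)) :
    (∃ q' x', d = (.inl q', x'.map .inl) ∧ Run G₁.Step (q, x) w (q', x')) ∨
    ∃ u v f s q' x', w = u ++ v ∧ Run G₁.Step (q, x) u (f, []) ∧ bridge f s ∧
      Run G₂.Step (s, []) v (q', x') ∧ d = (.inr q', x'.map .inr) := by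
  induction h generalizing q x with
  | refl => exact .inl ⟨q, x, hc, .refl _⟩
  | @head c d e o w hs hr ih =>
    subst hc
    have extend : ∀ q' x', G₁.Step (q, x) o (q', x') → d = (.inl q', x'.map .inl) →
        (∃ q' x', e = (.inl q', x'.map .inl) ∧ Run G₁.Step (q, x) (o.toList ++ w) (q', x')) ∨
        ∃ u v f s q' x', o.toList ++ w = u ++ v ∧ Run G₁.Step (q, x) u (f, []) ∧ bridge f s ∧
          Run G₂.Step (s, []) v (q', x') ∧ e = (.inr q', x'.map .inr) := by
      intro q' x' hs hd
      rcases ih hd with ⟨q'', x'', he, hr'⟩ | ⟨u, v, f, s, q'', x'', rfl, h₁, h₂, h₃, he⟩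
      · exact .inl ⟨q'', x'', he, .head hs hr'⟩
      · exact .inr ⟨o.toList ++ u, v, f, s, q'', x'', by simp, .head hs h₁, h₂, h₃, he⟩
    rcases hs with ⟨_, ⟨t, ht, rfl⟩ | ⟨t, ht, rfl⟩, h⟩ | ⟨rfl, hj, hx, hx'⟩
    · obtain ⟨hq, x', hf, rfl⟩ := h.of_map Sum.inl_injective
      cases hq
      exact extend _ _ (.inl ⟨t, ht, hf⟩) rfl
    · obtain ⟨y, h, -⟩ := h
      cases h
    · obtain ⟨q' | q', x'⟩ := d
      · obtain rfl : x' = [] := hx'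
        obtain rfl : x = [] := by simpa using hx
        exact extend q' [] (.inr ⟨rfl, hj, rfl, rfl⟩) rfl
      · obtain rfl : x' = [] := hx'
        obtain rfl : x = [] := by simpa using hx
        obtain ⟨q'', x'', he, hr'⟩ := exists_of_sum_run_inr hr (q := q') (x := []) rfl
        exact .inr ⟨[], w, q, q', q'', x'', rfl, .refl _, hj, hr', he⟩

end Sum

theorem sum_language_union [Finite Q₂] (G₁ : RankedAutomaton α Γ₁ Q₁)
    (G₂ : RankedAutomaton α Γ₂ Q₂) :
    (G₁.sum G₂ (fun _ _ => False) (Sum.elim (· ∈ G₁.start) (· ∈ G₂.start))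
      (Sum.elim (· ∈ G₁.final) (· ∈ G₂.final))).language = G₁.language + G₂.language := by
  ext w
  rw [Language.mem_add]
  constructor
  · rintro ⟨s | s, hs, f, hf, h⟩
    · rcases exists_of_sum_run_inl h (x := []) rfl with
        ⟨q, x, he, hr⟩ | ⟨u, v, f, s, q', x', rfl, h₁, h₂, h₃, he⟩
      · simp only [Prod.mk.injEq, List.nil_eq, List.map_eq_nil_iff] at he
        obtain ⟨rfl, rfl⟩ := he
        exact .inl ⟨s, hs, q, hf, hr⟩
      · exact h₂.elim
    · obtain ⟨q, x, he, hr⟩ := exists_of_sum_run_inr h (x := []) rfl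
      simp only [Prod.mk.injEq, List.nil_eq, List.map_eq_nil_iff] at he
      obtain ⟨rfl, rfl⟩ := he
      exact .inr ⟨s, hs, q, hf, hr⟩
  · rintro (⟨s, hs, f, hf, h⟩ | ⟨s, hs, f, hf, h⟩)
    · exact ⟨.inl s, hs, .inl f, hf, sum_run_inl h⟩
    · exact ⟨.inr s, hs, .inr f, hf, sum_run_inr h⟩

theorem sum_language_mul [Finite Q₂] (G₁ : RankedAutomaton α Γ₁ Q₁)
    (G₂ : RankedAutomaton α Γ₂ Q₂) :
    (G₁.sum G₂ (fun p q => p ∈ G₁.final ∧ q ∈ G₂.start) (Sum.inl '' G₁.start)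
      (Sum.inr '' G₂.final)).language = G₁.language * G₂.language := by
  ext w
  rw [Language.mem_mul]
  constructor
  · rintro ⟨_, ⟨s, hs, rfl⟩, _, ⟨f, hf, rfl⟩, h⟩
    rcases exists_of_sum_run_inl h (x := []) rfl with
      ⟨q, x, he, hr⟩ | ⟨u, v, f', s', q', x', rfl, h₁, h₂, h₃, he⟩
    · simp at he
    · simp only [Prod.mk.injEq, List.nil_eq, List.map_eq_nil_iff, Sum.inr.injEq] at he
      obtain ⟨rfl, rfl⟩ := he
      exact ⟨u, ⟨s, hs, f', h₂.1, h₁⟩, v, ⟨s', h₂.2, f, hf, h₃⟩, rfl⟩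
  · rintro ⟨u, ⟨s, hs, f, hf, h⟩, v, ⟨s', hs', f', hf', h'⟩, rfl⟩
    refine ⟨_, ⟨s, hs, rfl⟩, _, ⟨f', hf', rfl⟩, Run.trans (sum_run_inl h) ?_⟩
    refine .silent (d := (.inr s', [])) (.inr ⟨rfl, ?_, rfl, rfl⟩) (sum_run_inr h')
    exact ⟨hf, hs'⟩

/-! ### Kleene plus -/

/-- `G` with a bit in the state that records whether a letter has been read since the last start. A
run that has read a letter may start again from a final state with the empty deque. Excluding the
runs that have read nothing costs no word of `L⁺`, and it keeps silent cycles out. -/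
noncomputable def plus [Finite Q] (G : RankedAutomaton α Γ Q) :
    RankedAutomaton α Γ (Q × Bool) where
  start := {s | s.1 ∈ G.start ∧ s.2 = false}
  final := {s | s.1 ∈ G.final}
  trans := {t' | ∃ t ∈ G.trans, ∃ b : Bool,
    t' = { t with src := (t.src, b), dst := (t.dst, b || t.input.isSome) }}
  jump p q := (G.jump p.1 q.1 ∧ p.2 = q.2) ∨
    (p.1 ∈ G.final ∧ p.2 = true ∧ q.1 ∈ G.start ∧ q.2 = false)
  rank s := G.rank s.1 + if s.2 then G.exists_rank_le.choose + 1 else 0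
  trans_finite := by
    refine ((G.trans_finite.prod (Set.toFinite (Set.univ : Set Bool))).image
      fun x => ({ x.1 with src := (x.1.src, x.2), dst := (x.1.dst, x.2 || x.1.input.isSome) } :
        Transition α Γ (Q × Bool))).subset ?_
    rintro _ ⟨t, ht, b, rfl⟩
    exact ⟨(t, b), ⟨ht, trivial⟩, rfl⟩
  rank_trans := by
    rintro _ ⟨t, ht, b, rfl⟩ ho
    have := G.rank_trans t ht ho
    simp only at ho
    simp only [ho, Option.isSome_none, Bool.or_false]
    omega
  rank_jump := by
    rintro ⟨p, b⟩ ⟨q, b'⟩ (⟨h, hb⟩ | ⟨_, hb, _, hb'⟩)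
    · have := G.rank_jump p q h
      simp only at hb
      subst hb
      simp only
      omega
    · have := G.exists_rank_le.choose_spec q
      simp only at hb hb'
      subst hb hb'
      simp only [if_true, Bool.false_eq_true, if_false]
      omega

/-- The bit of `plus` records whether the word read so far is nonempty. -/
theorem plus_run [Finite Q] (G : RankedAutomaton α Γ Q) {c d : Q × List Γ} {w : List α}
    (h : Run G.Step c w d) (b : Bool) :
    Run G.plus.Step ((c.1, b), c.2) w ((d.1, b || !w.isEmpty), d.2) := by
  induction h generalizing b with
  | refl => simpa using Run.refl _
  | @head c d e o w hs hr ih =>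
    have hb : (b || !(o.toList ++ w).isEmpty) = ((b || o.isSome) || !w.isEmpty) := by
      cases o <;> simp
    rw [hb]
    refine .head ?_ (ih (b || o.isSome))
    rcases hs with ⟨t, ht, y, rfl, rfl, rfl⟩ | ⟨rfl, hj, hx, hx'⟩
    · exact .inl ⟨_, ⟨t, ht, b, rfl⟩, y, rfl, rfl, rfl⟩
    · exact .inr ⟨rfl, .inl ⟨hj, by simp⟩, hx, hx'⟩

theorem plus_language [Finite Q] (G : RankedAutomaton α Γ Q) :
    G.plus.language = G.language * G.language∗ := by
  ext w
  rw [Language.mem_mul]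
  constructor
  · rintro ⟨s, hs, f, hf, h⟩
    have key : ∀ (c d : (Q × Bool) × List Γ) (w : List α), Run G.plus.Step c w d →
        d.1.1 ∈ G.final → d.2 = [] → ∃ f ∈ G.final, ∃ u, Run G.Step (c.1.1, c.2) u (f, []) ∧
          ∃ v ∈ G.language∗, u ++ v = w := by
      intro c d w h hd₁ hd₂
      induction h with
      | refl c =>
        refine ⟨c.1.1, hd₁, [], ?_, [], Language.nil_mem_kstar _, rfl⟩
        rw [hd₂]
        exact .refl _
      | @head c d e o w hs hr ih =>
        obtain ⟨f, hf, u, hu, v, hv, rfl⟩ := ih hd₁ hd₂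
        rcases hs with ⟨_, ⟨t, ht, b, rfl⟩, y, rfl, rfl, rfl⟩ | ⟨rfl, hj, hx, hx'⟩
        · exact ⟨f, hf, t.input.toList ++ u, .head (.inl ⟨t, ht, y, rfl, rfl, rfl⟩) hu, v, hv,
            by simp⟩
        · rcases hj with ⟨hj, -⟩ | ⟨hf', -, hs', -⟩
          · exact ⟨f, hf, u, .silent (.inr ⟨rfl, hj, hx, hx'⟩) hu, v, hv, rfl⟩
          · refine ⟨c.1.1, hf', [], by rw [hx]; exact .refl _, u ++ v, ?_, rfl⟩
            rw [hx'] at hu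
            rw [← Language.one_add_self_mul_kstar_eq_kstar, Language.mem_add]
            exact .inr (Language.mem_mul.2 ⟨u, ⟨_, hs', f, hf, hu⟩, v, hv, rfl⟩)
    obtain ⟨f', hf', u, hu, v, hv, rfl⟩ := key _ _ _ h hf rfl
    exact ⟨u, ⟨s.1, hs.1, f', hf', hu⟩, v, hv, rfl⟩
  · rintro ⟨u, hu, v, hv, rfl⟩
    obtain ⟨S, rfl, hS⟩ := Language.mem_kstar_iff_exists_nonempty.1 hv
    -- the factors are taken to be nonempty, so that every one of them sets the bit
    have key : ∀ (S : List (List α)), (∀ y ∈ S, y ∈ G.language ∧ y ≠ []) →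
        ∀ y ∈ G.language, y ≠ [] → y ++ S.flatten ∈ G.plus.language := by
      intro S
      induction S with
      | nil =>
        rintro - y ⟨s, hs, f, hf, h⟩ -
        exact ⟨(s, false), ⟨hs, rfl⟩, (f, _), hf, by simpa using G.plus_run h false⟩
      | cons z S ih =>
        rintro hS y ⟨s, hs, f, hf, h⟩ hy
        obtain ⟨s', hs', f', hf', h'⟩ := ih (fun y hy => hS y (List.mem_cons_of_mem _ hy)) z
          (hS z List.mem_cons_self).1 (hS z List.mem_cons_self).2
        refine ⟨(s, false), ⟨hs, rfl⟩, f', hf', (G.plus_run h false).trans ?_⟩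
        exact .silent (d := (s', []))
          (.inr ⟨rfl, .inr ⟨hf, by simpa using hy, hs'.1, hs'.2⟩, rfl, rfl⟩) h'
    by_cases hu' : u = []
    · subst hu'
      cases S with
      | nil =>
        obtain ⟨s, hs, f, hf, h⟩ := hu
        exact ⟨(s, false), ⟨hs, rfl⟩, (f, _), hf, G.plus_run h false⟩
      | cons z S =>
        exact key S (fun y hy => hS y (List.mem_cons_of_mem _ hy)) z
          (hS z List.mem_cons_self).1 (hS z List.mem_cons_self).2
    · exact key S hS u hu hu'

/-! ### Intersection with regular languages -/

/-- The product of a ranked automaton with a deterministic finite automaton. -/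
def interDFA {σ : Type} [Finite σ] (G : RankedAutomaton α Γ Q) (D : DFA α σ) :
    RankedAutomaton α Γ (Q × σ) where
  start := {s | s.1 ∈ G.start ∧ s.2 = D.start}
  final := {s | s.1 ∈ G.final ∧ s.2 ∈ D.accept}
  trans := {t' | ∃ t ∈ G.trans, ∃ r : σ,
    t' = { t with src := (t.src, r), dst := (t.dst, D.evalFrom r t.input.toList) }}
  jump p q := G.jump p.1 q.1 ∧ p.2 = q.2
  rank s := G.rank s.1
  trans_finite := by
    refine ((G.trans_finite.prod (Set.toFinite (Set.univ : Set σ))).image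
      fun x => ({ x.1 with
        src := (x.1.src, x.2), dst := (x.1.dst, D.evalFrom x.2 x.1.input.toList) } :
        Transition α Γ (Q × σ))).subset ?_
    rintro _ ⟨t, ht, b, rfl⟩
    exact ⟨(t, b), ⟨ht, trivial⟩, rfl⟩
  rank_trans := by
    rintro _ ⟨t, ht, b, rfl⟩ ho
    exact G.rank_trans t ht ho
  rank_jump _ _ h := G.rank_jump _ _ h.1

theorem interDFA_language {σ : Type} [Finite σ] (G : RankedAutomaton α Γ Q) (D : DFA α σ) :
    (G.interDFA D).language = G.language ⊓ D.accepts := by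
  ext w
  constructor
  · rintro ⟨⟨s, r⟩, ⟨hs, hr⟩, ⟨f, r'⟩, ⟨hf, hr'⟩, h⟩
    have key : ∀ c d w, Run (G.interDFA D).Step c w d →
        Run G.Step (c.1.1, c.2) w (d.1.1, d.2) ∧ D.evalFrom c.1.2 w = d.1.2 := by
      intro c d w h
      induction h with
      | refl => exact ⟨.refl _, rfl⟩
      | head hs _ ih =>
        rcases hs with ⟨_, ⟨t, ht, r, rfl⟩, y, rfl, rfl, rfl⟩ | ⟨rfl, ⟨hj, hr⟩, hx, hx'⟩
        · refine ⟨.head (.inl ⟨t, ht, y, rfl, rfl, rfl⟩) ih.1, ?_⟩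
          rw [DFA.evalFrom_of_append]
          exact ih.2
        · exact ⟨.silent (.inr ⟨rfl, hj, hx, hx'⟩) ih.1, by rw [hr]; exact ih.2⟩
    simp only at hs hr hf hr'
    subst hr
    obtain ⟨h₁, h₂⟩ := key _ _ _ h
    refine ⟨⟨s, hs, f, hf, h₁⟩, ?_⟩
    change D.evalFrom D.start w ∈ D.accept
    rw [h₂]
    exact hr'
  · rintro ⟨⟨s, hs, f, hf, h⟩, hD⟩
    have key : ∀ c d w, Run G.Step c w d → ∀ r,
        Run (G.interDFA D).Step ((c.1, r), c.2) w ((d.1, D.evalFrom r w), d.2) := by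
      intro c d w h
      induction h with
      | refl => exact fun r => .refl _
      | @head c d e o w hs _ ih =>
        intro r
        rw [DFA.evalFrom_of_append]
        refine .head ?_ (ih _)
        rcases hs with ⟨t, ht, y, rfl, rfl, rfl⟩ | ⟨rfl, hj, hx, hx'⟩
        · exact .inl ⟨_, ⟨t, ht, r, rfl⟩, y, rfl, rfl, rfl⟩
        · exact .inr ⟨rfl, ⟨hj, rfl⟩, hx, hx'⟩
    exact ⟨(s, D.start), ⟨hs, rfl⟩, (f, _), ⟨hf, hD⟩, key _ _ _ h _⟩

end RankedAutomaton

/-! ### Homomorphisms and inverse homomorphisms -/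

/-- The four words that a transition removes from the deque and writes to it. -/
def Transition.words {α Γ Q : Type} (t : Transition α Γ Q) :
    List Γ × List Γ × List Γ × List Γ :=
  (t.readFront, t.readTail, t.writeFront, t.writeTail)

theorem Transition.finite_of_words {α Γ Q : Type} [Finite α] [Finite Q]
    {W : Set (List Γ × List Γ × List Γ × List Γ)} (hW : W.Finite)
    {T : Set (Transition α Γ Q)} (h : ∀ t ∈ T, t.words ∈ W) : T.Finite := by
  refine Set.Finite.of_finite_image
    (f := fun t => ((t.src, t.input, t.dst), t.words)) ?_ ?_
  · refine ((Set.toFinite (Set.univ : Set (Q × Option α × Q))).prod hW).subset ?_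
    rintro _ ⟨t, ht, rfl⟩
    exact ⟨trivial, h t ht⟩
  · rintro ⟨⟩ - ⟨⟩ - h
    simp only [Prod.mk.injEq, Transition.words] at h
    simp only [Transition.mk.injEq]
    tauto

/-- Words of length at most `N`. -/
abbrev Buffer (β : Type) (N : ℕ) : Type := {l : List β // l.length ≤ N}

instance {β : Type} [Finite β] {N : ℕ} : Finite (Buffer β N) :=
  (List.finite_length_le β N).to_subtype

/-- The empty buffer. -/
def Buffer.empty {β : Type} {N : ℕ} : Buffer β N := ⟨[], Nat.zero_le N⟩

/-- The buffer without the first letter. -/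
def Buffer.rest {β : Type} {N : ℕ} {b : β} {l : List β} (h : (b :: l).length ≤ N) :
    Buffer β N := ⟨l, (Nat.le_succ _).trans h⟩

theorem exists_length_le {α β : Type} [Finite α] (h : α → List β) :
    ∃ N, ∀ a, (h a).length ≤ N := by
  obtain ⟨B, hB⟩ := (Set.finite_range fun a => (h a).length).bddAbove
  exact ⟨B, fun a => hB ⟨a, rfl⟩⟩

namespace RankedAutomaton

variable {α β Γ Q : Type}

/-- The transitions of `hom`. -/
inductive HomTransition (G : RankedAutomaton α Γ Q) (h : α → List β) (N : ℕ) :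
    Transition β Γ (Q × Buffer β N) → Prop
  | silent (t : Transition α Γ Q) : t ∈ G.trans → t.input = none →
      HomTransition G h N ⟨(t.src, .empty), none, t.readFront, t.readTail, (t.dst, .empty),
        t.writeFront, t.writeTail⟩
  | read (t : Transition α Γ Q) (a : α) (b : β) (l : List β) (hl : (b :: l).length ≤ N) :
      t ∈ G.trans → t.input = some a → h a = b :: l →
      HomTransition G h N ⟨(t.src, .empty), some b, t.readFront, t.readTail, (t.dst, .rest hl),
        t.writeFront, t.writeTail⟩
  | rest (q : Q) (b : β) (l : List β) (hl : (b :: l).length ≤ N) :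
      HomTransition G h N ⟨(q, ⟨b :: l, hl⟩), some b, [], [], (q, .rest hl), [], []⟩

/-- An automaton for the image under a nonerasing homomorphism `h`: it guesses the letter `a` that `G`
reads, makes the move of `G` while reading the first letter of `h a`, and then reads the rest of
`h a`, which it keeps in the state. -/
def hom [Finite β] [Finite Q] (G : RankedAutomaton α Γ Q) (h : α → List β) (N : ℕ) :
    RankedAutomaton β Γ (Q × Buffer β N) where
  start := {s | s.1 ∈ G.start ∧ s.2 = .empty}
  final := {s | s.1 ∈ G.final ∧ s.2 = .empty}
  trans := {t | HomTransition G h N t}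
  jump p q := G.jump p.1 q.1 ∧ p.2 = .empty ∧ q.2 = .empty
  rank s := G.rank s.1
  trans_finite := by
    refine Transition.finite_of_words
      ((G.trans_finite.image Transition.words).insert ([], [], [], [])) ?_
    rintro _ (⟨t, ht, _⟩ | ⟨t, a, b, l, hl, ht, _⟩ | _)
    · exact .inr ⟨t, ht, rfl⟩
    · exact .inr ⟨t, ht, rfl⟩
    · exact .inl rfl
  rank_trans := by
    rintro _ (⟨t, ht, ht'⟩ | ⟨t, a, b, l, hl, ht, ht'⟩ | _) ho
    · exact G.rank_trans t ht ht'
    · cases ho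
    · cases ho
  rank_jump _ _ h := G.rank_jump _ _ h.1

theorem hom_language [Finite β] [Finite Q] (G : RankedAutomaton α Γ Q) {h : α → List β} {N : ℕ}
    (hh : Nonerasing h) (hN : ∀ a, (h a).length ≤ N) :
    (G.hom h N).language = homImage h G.language := by
  ext w
  constructor
  · rintro ⟨⟨s, l⟩, ⟨hs, hl⟩, ⟨f, l'⟩, ⟨hf, hl'⟩, hr⟩
    have key : ∀ c d w, Run (G.hom h N).Step c w d → d.1.2 = .empty →
        ∃ v, c.1.2.1 ++ wordHom h v = w ∧ Run G.Step (c.1.1, c.2) v (d.1.1, d.2) := by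
      intro c d w hr hd
      induction hr with
      | refl => exact ⟨[], by rw [hd]; rfl, .refl _⟩
      | head hs _ ih =>
        obtain ⟨v, rfl, hv⟩ := ih hd
        rcases hs with ⟨_, ht, y, rfl, rfl, rfl⟩ | ⟨rfl, ⟨hj, hl, hl'⟩, hx, hx'⟩
        · cases ht with
          | silent t ht ho =>
            exact ⟨v, rfl, .silent (.inl ⟨t, ht, y, rfl, ho.symm, rfl⟩) hv⟩
          | read t a b l hl ht ho hab =>
            refine ⟨a :: v, ?_, .letter (.inl ⟨t, ht, y, rfl, ho.symm, rfl⟩) hv⟩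
            simp [wordHom, hab, Buffer.rest, Buffer.empty]
          | rest q b l hl => exact ⟨v, rfl, by simpa using hv⟩
        · exact ⟨v, by rw [hl, hl']; rfl, .silent (.inr ⟨rfl, hj, hx, hx'⟩) hv⟩
    simp only at hl hl' hs hf
    obtain ⟨v, hv, hr'⟩ := key _ _ _ hr hl'
    subst hl hl'
    exact ⟨v, ⟨s, hs, f, hf, hr'⟩, hv⟩
  · rintro ⟨v, ⟨s, hs, f, hf, hr⟩, rfl⟩
    have drain : ∀ (q : Q) (x : List Γ) (l : List β) (hl : l.length ≤ N),
        Run (G.hom h N).Step ((q, ⟨l, hl⟩), x) l ((q, .empty), x) := by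
      intro q x l
      induction l with
      | nil => exact fun _ => .refl _
      | cons b l ih =>
        exact fun hl => .letter (.inl ⟨_, .rest q b l hl, x, by simp, rfl, by simp [Buffer.rest]⟩)
          (ih (Nat.le_of_succ_le hl))
    have key : ∀ c d v, Run G.Step c v d →
        Run (G.hom h N).Step ((c.1, .empty), c.2) (wordHom h v) ((d.1, .empty), d.2) := by
      intro c d v hr
      induction hr with
      | refl => exact .refl _
      | @head c d e o w hs _ ih =>
        rcases hs with ⟨t, ht, y, rfl, rfl, rfl⟩ | ⟨rfl, hj, hx, hx'⟩
        · cases ho : t.input with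
          | none =>
            exact .silent (.inl ⟨_, .silent t ht ho, y, rfl, rfl, rfl⟩) ih
          | some a =>
            obtain ⟨b, l, hab⟩ := List.exists_cons_of_ne_nil (hh a)
            have hl : (b :: l).length ≤ N := hab ▸ hN a
            have hw : wordHom h ((some a).toList ++ w) = b :: (l ++ wordHom h w) := by
              simp [wordHom, hab]
            rw [hw]
            exact .letter (.inl ⟨_, .read t a b l hl ht ho hab, y, rfl, rfl, rfl⟩)
              ((drain _ _ _ _).trans ih)
        · exact .silent (.inr ⟨rfl, ⟨hj, rfl, rfl⟩, hx, hx'⟩) ih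
    exact ⟨(s, .empty), ⟨hs, rfl⟩, (f, .empty), ⟨hf, rfl⟩, key _ _ _ hr⟩

/-- The transitions of `invHom`. -/
inductive InvHomTransition (G : RankedAutomaton β Γ Q) (g : α → List β) (N : ℕ) :
    Transition α Γ (Q × Buffer β N) → Prop
  | silent (t : Transition β Γ Q) (l : Buffer β N) : t ∈ G.trans → t.input = none →
      InvHomTransition G g N ⟨(t.src, l), none, t.readFront, t.readTail, (t.dst, l),
        t.writeFront, t.writeTail⟩
  | consume (t : Transition β Γ Q) (b : β) (l : List β) (hl : (b :: l).length ≤ N) :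
      t ∈ G.trans → t.input = some b →
      InvHomTransition G g N ⟨(t.src, ⟨b :: l, hl⟩), none, t.readFront, t.readTail,
        (t.dst, .rest hl), t.writeFront, t.writeTail⟩
  | load (q : Q) (a : α) (hl : (g a).length ≤ N) :
      InvHomTransition G g N ⟨(q, .empty), some a, [], [], (q, ⟨g a, hl⟩), [], []⟩

/-- An automaton for the preimage under a homomorphism `g`: it keeps the part of `g a` that `G` has not
read yet in a buffer, and simulates `G` on the buffer without reading. -/
noncomputable def invHom [Finite α] [Finite β] [Finite Q] (G : RankedAutomaton β Γ Q)
    (g : α → List β) (N : ℕ) : RankedAutomaton α Γ (Q × Buffer β N) where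
  start := {s | s.1 ∈ G.start ∧ s.2 = .empty}
  final := {s | s.1 ∈ G.final ∧ s.2 = .empty}
  trans := {t | InvHomTransition G g N t}
  jump p q := G.jump p.1 q.1 ∧ p.2 = q.2
  rank s := G.rank s.1 + s.2.1.length * (G.exists_rank_le.choose + 1)
  trans_finite := by
    refine Transition.finite_of_words
      ((G.trans_finite.image Transition.words).insert ([], [], [], [])) ?_
    rintro _ (⟨t, l, ht, _⟩ | ⟨t, b, l, hl, ht, _⟩ | _)
    · exact .inr ⟨t, ht, rfl⟩
    · exact .inr ⟨t, ht, rfl⟩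
    · exact .inl rfl
  rank_trans := by
    rintro _ (⟨t, l, ht, ht'⟩ | ⟨t, b, l, hl, ht, ht'⟩ | _) ho
    · have := G.rank_trans t ht ht'
      simp only
      omega
    · have := G.exists_rank_le.choose_spec t.dst
      simp only [Buffer.rest, List.length_cons, Nat.succ_mul]
      omega
    · cases ho
  rank_jump := by
    rintro ⟨p, l⟩ ⟨q, l'⟩ ⟨h, hl⟩
    have := G.rank_jump p q h
    simp only at hl
    subst hl
    simp only
    omega

theorem invHom_language [Finite α] [Finite β] [Finite Q] (G : RankedAutomaton β Γ Q)
    {g : α → List β} {N : ℕ} (hN : ∀ a, (g a).length ≤ N) :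
    (G.invHom g N).language = homPreimage g G.language := by
  ext w
  constructor
  · rintro ⟨⟨s, l⟩, ⟨hs, hl⟩, ⟨f, l'⟩, ⟨hf, hl'⟩, hr⟩
    have key : ∀ c d w, Run (G.invHom g N).Step c w d → d.1.2 = .empty →
        Run G.Step (c.1.1, c.2) (c.1.2.1 ++ wordHom g w) (d.1.1, d.2) := by
      intro c d w hr hd
      induction hr with
      | refl => rw [hd]; exact .refl _
      | head hs _ ih =>
        have hv := ih hd
        rcases hs with ⟨_, ht, y, rfl, rfl, rfl⟩ | ⟨rfl, ⟨hj, hl⟩, hx, hx'⟩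
        · cases ht with
          | silent t l ht ho => exact .silent (.inl ⟨t, ht, y, rfl, ho.symm, rfl⟩) hv
          | consume t b l hl ht ho => exact .letter (.inl ⟨t, ht, y, rfl, ho.symm, rfl⟩) hv
          | load q a hl => simpa [wordHom, Buffer.empty] using hv
        · rw [hl]
          exact .silent (.inr ⟨rfl, hj, hx, hx'⟩) hv
    simp only at hl hl' hs hf
    have hr' := key _ _ _ hr hl'
    subst hl hl'
    exact ⟨s, hs, f, hf, hr'⟩
  · rintro ⟨s, hs, f, hf, hr⟩
    have key : ∀ c d u, Run G.Step c u d → ∀ (l : Buffer β N) (v : List α),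
        u = l.1 ++ wordHom g v →
        Run (G.invHom g N).Step ((c.1, l), c.2) v ((d.1, .empty), d.2) := by
      -- letters with empty image are read until the buffer is filled
      have load : ∀ (c e : (Q × Buffer β N) × List Γ) (b : β) (u : List β), c.1.2 = .empty →
          (∀ (l : List β) (hl : (b :: l).length ≤ N) (v : List α), u = l ++ wordHom g v →
            Run (G.invHom g N).Step ((c.1.1, ⟨b :: l, hl⟩), c.2) v e) →
          ∀ v, b :: u = wordHom g v → Run (G.invHom g N).Step c v e := by
        rintro ⟨⟨q, l⟩, x⟩ e b u hl hcons v
        simp only at hl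
        subst hl
        induction v with
        | nil => intro h; cases h
        | cons a v ih =>
          intro h
          have hs : (G.invHom g N).Step ((q, .empty), x) (some a) ((q, ⟨g a, hN a⟩), x) :=
            .inl ⟨_, .load q a (hN a), x, by simp, rfl, by simp⟩
          have filled : ∀ (l : List β) (hl : l.length ≤ N), g a = l →
              Run (G.invHom g N).Step ((q, ⟨l, hl⟩), x) v e := by
            rintro (_ | ⟨b', l⟩) hl hga
            · exact ih (by simpa [wordHom, hga] using h)
            · have h' : b = b' ∧ u = l ++ wordHom g v := by simpa [wordHom, hga] using h
              obtain ⟨rfl, h'⟩ := h'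
              exact hcons l hl v h'
          exact .letter hs (filled _ _ rfl)
      intro c d u hr
      induction hr with
      | refl c =>
        rintro ⟨l, hl⟩ v h
        obtain ⟨rfl, hv⟩ : l = [] ∧ wordHom g v = [] := by simpa using h.symm
        clear h
        induction v with
        | nil => exact .refl _
        | cons a v ih =>
          obtain ⟨ha, hv⟩ : g a = [] ∧ wordHom g v = [] := by simpa [wordHom] using hv
          have hs : (G.invHom g N).Step ((c.1, .empty), c.2) (some a)
              ((c.1, ⟨g a, hN a⟩), c.2) :=
            .inl ⟨_, .load c.1 a (hN a), c.2, by simp, rfl, by simp⟩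
          exact .letter hs (by simpa [ha] using ih hv)
      | @head c d e o w hs _ ih =>
        intro l v h
        rcases hs with ⟨t, ht, y, rfl, rfl, rfl⟩ | ⟨rfl, hj, hx, hx'⟩
        · cases ho : t.input with
          | none =>
            rw [ho] at h
            exact .silent (.inl ⟨_, .silent t l ht ho, y, rfl, rfl, rfl⟩) (ih l v h)
          | some b =>
            rw [ho] at h
            have hcons : ∀ (l : List β) (hl : (b :: l).length ≤ N) (v : List α),
                w = l ++ wordHom g v → Run (G.invHom g N).Step
                  ((t.src, ⟨b :: l, hl⟩), t.readFront ++ y ++ t.readTail) v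
                  ((e.1, .empty), e.2) := fun l hl v hw =>
              .silent (.inl ⟨_, .consume t b l hl ht ho, y, rfl, rfl, rfl⟩)
                (ih (.rest hl) v hw)
            obtain ⟨_ | ⟨b', l⟩, hl⟩ := l
            · exact load _ _ b w rfl hcons v h
            · simp only [Option.toList_some, List.cons_append, List.nil_append,
                List.cons.injEq] at h
              obtain ⟨rfl, h⟩ := h
              exact hcons l hl v h
        · exact .silent (d := ((d.1, l), d.2)) (.inr ⟨rfl, ⟨hj, rfl⟩, hx, hx'⟩) (ih l v h)
    exact ⟨(s, .empty), ⟨hs, rfl⟩, (f, .empty), ⟨hf, rfl⟩, key _ _ _ hr .empty w rfl⟩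

end RankedAutomaton

/-! ### The closure properties of the deque languages -/

theorem one_mem_dequeLanguages (α : Type) [Finite α] : (1 : Language α) ∈ dequeLanguages α := by
  let G : RankedAutomaton α Unit Unit :=
    { start := Set.univ, final := Set.univ, trans := ∅, jump := fun _ _ => False,
      rank := fun _ => 0, trans_finite := Set.finite_empty,
      rank_trans := fun _ h => h.elim, rank_jump := fun _ _ h => h.elim }
  refine mem_dequeLanguages_iff.2 ⟨Unit, Unit, inferInstance, inferInstance, G, ?_⟩
  ext w
  rw [Language.mem_one]
  constructor
  · rintro ⟨s, -, f, -, h⟩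
    cases h with
    | refl => rfl
    | head hs _ => rcases hs with ⟨t, ht, _⟩ | ⟨_, h, _⟩ <;> exact False.elim ‹_›
  · rintro rfl
    exact ⟨(), trivial, (), trivial, .refl _⟩

theorem closedUnderUnion_dequeLanguages : ClosedUnderUnion dequeLanguages := by
  intro α _ L₁ L₂ h₁ h₂
  obtain ⟨Γ₁, Q₁, _, _, G₁, rfl⟩ := mem_dequeLanguages_iff.1 h₁
  obtain ⟨Γ₂, Q₂, _, _, G₂, rfl⟩ := mem_dequeLanguages_iff.1 h₂
  exact mem_dequeLanguages_iff.2 ⟨_, _, inferInstance, inferInstance, _,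
    G₁.sum_language_union G₂⟩

theorem closedUnderConcatenation_dequeLanguages : ClosedUnderConcatenation dequeLanguages := by
  intro α _ L₁ L₂ h₁ h₂
  obtain ⟨Γ₁, Q₁, _, _, G₁, rfl⟩ := mem_dequeLanguages_iff.1 h₁
  obtain ⟨Γ₂, Q₂, _, _, G₂, rfl⟩ := mem_dequeLanguages_iff.1 h₂
  exact mem_dequeLanguages_iff.2 ⟨_, _, inferInstance, inferInstance, _,
    G₁.sum_language_mul G₂⟩

theorem closedUnderKleenePlus_dequeLanguages : ClosedUnderKleenePlus dequeLanguages := by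
  intro α _ L h
  obtain ⟨Γ, Q, _, _, G, rfl⟩ := mem_dequeLanguages_iff.1 h
  exact mem_dequeLanguages_iff.2 ⟨_, _, inferInstance, inferInstance, _, G.plus_language⟩

theorem closedUnderKleeneStar_dequeLanguages : ClosedUnderKleeneStar dequeLanguages := by
  intro α _ L h
  rw [← Language.one_add_self_mul_kstar_eq_kstar]
  exact closedUnderUnion_dequeLanguages α _ _ (one_mem_dequeLanguages α)
    (closedUnderKleenePlus_dequeLanguages α L h)

theorem isAFL_dequeLanguages : IsAFL dequeLanguages where
  nontrivial := ⟨Unit, inferInstance, 1, one_mem_dequeLanguages Unit, [], rfl⟩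
  union := closedUnderUnion_dequeLanguages
  concatenation := closedUnderConcatenation_dequeLanguages
  kleenePlus := closedUnderKleenePlus_dequeLanguages
  regularIntersection := by
    rintro α _ L R h ⟨σ, _, D, rfl⟩
    obtain ⟨Γ, Q, _, _, G, rfl⟩ := mem_dequeLanguages_iff.1 h
    exact mem_dequeLanguages_iff.2 ⟨_, _, inferInstance, inferInstance, _, G.interDFA_language D⟩
  nonerasingHom := by
    intro α β _ _ h L hh hL
    obtain ⟨Γ, Q, _, _, G, rfl⟩ := mem_dequeLanguages_iff.1 hL
    obtain ⟨N, hN⟩ := exists_length_le h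
    exact mem_dequeLanguages_iff.2 ⟨_, _, inferInstance, inferInstance, _, G.hom_language hh hN⟩
  inverseHom := by
    intro α β _ _ g L hL
    obtain ⟨Γ, Q, _, _, G, rfl⟩ := mem_dequeLanguages_iff.1 hL
    obtain ⟨N, hN⟩ := exists_length_le g
    exact mem_dequeLanguages_iff.2 ⟨_, _, inferInstance, inferInstance, _, G.invHom_language hN⟩

/-! ### Turing machines on a deque -/

section Simulation

variable {Γ Λ : Type}

/-- The states of the simulation of a Turing machine whose labels range over `S`. -/
inductive SimState (S : Set Λ)
  /-- the input word is being written into the deque -/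
  | load : SimState S
  /-- the Turing machine is in the state `q` -/
  | run (q : S) : SimState S
  /-- the Turing machine has halted and the deque is being emptied -/
  | clear : SimState S

theorem SimState.finite {S : Set Λ} (hS : S.Finite) : Finite (SimState S) := by
  have := hS.to_subtype
  refine Finite.of_surjective (α := Option (Option S))
    (fun s => match s with
      | none => .load
      | some none => .clear
      | some (some q) => .run q) ?_
  rintro (_ | q | _)
  · exact ⟨none, rfl⟩
  · exact ⟨some (some q), rfl⟩
  · exact ⟨some none, rfl⟩

/-- The deque content that stands for the tape with left part `L`, read from the head to the left, and
right part `R`, which begins at the head. -/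
def tapeWord (L R : List Γ) : List (Option Γ) := R.map some ++ none :: L.reverse.map some

theorem tapeWord_eq_cons {L R : List Γ} {a : Option Γ} {y : List (Option Γ)}
    (h : tapeWord L R = [a] ++ y ++ []) :
    (R = [] ∧ a = none ∧ y = L.reverse.map some) ∨
      ∃ b R', R = b :: R' ∧ a = some b ∧ y = tapeWord L R' := by
  cases R with
  | nil => simp [tapeWord] at h; simp [h]
  | cons b R => simp [tapeWord] at h; simp [tapeWord, h]

theorem tapeWord_eq_concat {L R : List Γ} {a : Option Γ} {y : List (Option Γ)}
    (h : tapeWord L R = y ++ [a]) :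
    (L = [] ∧ a = none ∧ y = R.map some) ∨
      ∃ b L', L = b :: L' ∧ a = some b ∧ y = tapeWord L' R := by
  cases L with
  | nil =>
    obtain ⟨h₁, h₂⟩ := List.append_inj' (h : R.map some ++ [none] = y ++ [a]) rfl
    exact .inl ⟨rfl, (List.head_eq_of_cons_eq h₂).symm, h₁.symm⟩
  | cons b L =>
    have h' : tapeWord L R ++ [some b] = y ++ [a] := by rw [← h]; simp [tapeWord]
    obtain ⟨h₁, h₂⟩ := List.append_inj' h' rfl
    simp only [List.cons.injEq, and_true] at h₂
    exact .inr ⟨b, L, rfl, h₂.symm, h₁.symm⟩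

variable [Inhabited Γ] [Inhabited Λ]

/-- The transitions of `simulation`. The input letter `none` is padding, and the deque symbol `none` is
the marker between the two halves of the tape. -/
inductive SimTransition (M : Turing.TM0.Machine Γ Λ) {S : Set Λ} (q₀ : S) :
    Transition (Option Γ) (Option Γ) (SimState S) → Prop
  | load (a : Γ) : SimTransition M q₀ ⟨.load, some (some a), [], [], .load, [], [some a]⟩
  | begin : SimTransition M q₀ ⟨.load, some none, [], [], .run q₀, [], [none]⟩
  | blankRight (q : S) : SimTransition M q₀
      ⟨.run q, some none, [none], [], .run q, [some default, none], []⟩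
  | blankLeft (q : S) : SimTransition M q₀
      ⟨.run q, some none, [], [none], .run q, [], [none, some default]⟩
  | write (q q' : S) (a b : Γ) : M q a = some (q'.1, .write b) → SimTransition M q₀
      ⟨.run q, some none, [some a], [], .run q', [some b], []⟩
  | right (q q' : S) (a : Γ) : M q a = some (q'.1, .move .right) → SimTransition M q₀
      ⟨.run q, some none, [some a], [], .run q', [], [some a]⟩
  | left (q q' : S) (a b : Γ) : M q a = some (q'.1, .move .left) → SimTransition M q₀
      ⟨.run q, some none, [some a], [some b], .run q', [some b, some a], []⟩
  | halt (q : S) (a : Γ) : M q a = none → SimTransition M q₀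
      ⟨.run q, some none, [some a], [], .clear, [], []⟩
  | clear (a : Option Γ) : SimTransition M q₀ ⟨.clear, some none, [a], [], .clear, [], []⟩

/-- The simulation of a Turing machine by a real-time deque automaton, whose every move reads a letter:
it loads the tape letter by letter, and then reads one padding letter with every move. The deque is
a circular tape: it holds the tape from the head to the right, the marker, and the tape to the left
of the head. -/
def simulation [Finite Γ] (M : Turing.TM0.Machine Γ Λ) {S : Set Λ} (hS : S.Finite) (q₀ : S) :
    RankedAutomaton (Option Γ) (Option Γ) (SimState S) where
  start := {.load}
  final := {.clear}
  trans := {t | SimTransition M q₀ t}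
  jump _ _ := False
  rank _ := 0
  trans_finite := by
    have := SimState.finite hS
    have h := List.finite_length_le (Option Γ) 2
    refine Transition.finite_of_words (h.prod (h.prod (h.prod h))) ?_
    rintro _ (_ | _ | _ | _ | _ | _ | _ | _ | _) <;> simp [Transition.words]
  rank_trans := by
    rintro _ (_ | _ | _ | _ | _ | _ | _ | _ | _) h <;> cases h
  rank_jump _ _ h := h.elim

theorem mk_nil_eq_mk_default : Turing.ListBlank.mk ([] : List Γ) = .mk [default] :=
  Quotient.sound (.inl ⟨1, rfl⟩)

open Turing in
/-- The Turing machine halts from the label `q` and the tape with halves `L` and `R`. -/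
def HaltsFrom (M : TM0.Machine Γ Λ) (q : Λ) (L R : List Γ) : Prop :=
  (StateTransition.eval (TM0.step M) ⟨q, Tape.mk' (.mk L) (.mk R)⟩).Dom

theorem haltsFrom_of_eq_none {M : Turing.TM0.Machine Γ Λ} {q : Λ} {L R : List Γ} {a : Γ}
    (h : M q a = none) : HaltsFrom M q L (a :: R) := by
  refine Part.dom_iff_mem.2 ⟨_, StateTransition.mem_eval.2 ⟨.refl, ?_⟩⟩
  simp [Turing.TM0.step, h]

theorem haltsFrom_congr {M : Turing.TM0.Machine Γ Λ} {q q' : Λ} {L R L' R' : List Γ}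
    (h : Turing.TM0.step M ⟨q, .mk' (.mk L) (.mk R)⟩ = some ⟨q', .mk' (.mk L') (.mk R')⟩) :
    HaltsFrom M q L R ↔ HaltsFrom M q' L' R' := by
  rw [HaltsFrom, HaltsFrom, StateTransition.reaches_eval (.single h)]

theorem step_write {M : Turing.TM0.Machine Γ Λ} {q q' : Λ} {a b : Γ} (L R : List Γ)
    (h : M q a = some (q', .write b)) :
    Turing.TM0.step M ⟨q, .mk' (.mk L) (.mk (a :: R))⟩ =
      some ⟨q', .mk' (.mk L) (.mk (b :: R))⟩ := by
  simp only [Turing.TM0.step, Turing.Tape.mk'_head, Turing.ListBlank.head_mk, List.headI, h,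
    Option.map_some]
  rfl

theorem step_right {M : Turing.TM0.Machine Γ Λ} {q q' : Λ} {a : Γ} (L R : List Γ)
    (h : M q a = some (q', .move .right)) :
    Turing.TM0.step M ⟨q, .mk' (.mk L) (.mk (a :: R))⟩ =
      some ⟨q', .mk' (.mk (a :: L)) (.mk R)⟩ := by
  simp only [Turing.TM0.step, Turing.Tape.mk'_head, Turing.ListBlank.head_mk, List.headI, h,
    Option.map_some, Turing.Tape.move_right_mk']
  rfl

theorem step_left {M : Turing.TM0.Machine Γ Λ} {q q' : Λ} {a b : Γ} (L R : List Γ)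
    (h : M q a = some (q', .move .left)) :
    Turing.TM0.step M ⟨q, .mk' (.mk (b :: L)) (.mk (a :: R))⟩ =
      some ⟨q', .mk' (.mk L) (.mk (b :: a :: R))⟩ := by
  simp only [Turing.TM0.step, Turing.Tape.mk'_head, Turing.ListBlank.head_mk, List.headI, h,
    Option.map_some, Turing.Tape.move_left_mk']
  rfl

variable [Finite Γ] {M : Turing.TM0.Machine Γ Λ} {S : Set Λ} {hS : S.Finite} {q₀ : S}

/-- What an accepting run of the simulation shows, for each of the three phases in which it may
begin. `wordHom Option.toList v` is `v` without the padding letters. -/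
theorem simulation_sound {c : SimState S × List (Option Γ)} {v : List (Option Γ)}
    (h : Run (simulation M hS q₀).Step c v (.clear, [])) :
    (c.1 = .clear → wordHom Option.toList v = []) ∧
    (∀ q L R, c = (.run q, tapeWord L R) → wordHom Option.toList v = [] ∧ HaltsFrom M q L R) ∧
    (∀ R, c = (.load, R.map some) → HaltsFrom M q₀ [] (R ++ wordHom Option.toList v)) := by
  generalize hd : (SimState.clear, ([] : List (Option Γ))) = d at h
  induction h with
  | refl => subst hd; simp [wordHom]
  | head hs hr ih =>
    obtain ⟨ih₁, ih₂, ih₃⟩ := ih hd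
    rcases hs with ⟨t, ht, y, rfl, rfl, rfl⟩ | ⟨_, h, _⟩
    swap
    · exact h.elim
    cases ht with
    | load a =>
      refine ⟨fun h => (by cases h), fun q L R h => (by cases h), fun R h => ?_⟩
      simp only [Prod.mk.injEq, List.nil_append, List.append_nil, true_and] at h
      subst h
      simpa [wordHom] using ih₃ (R ++ [a]) (by simp)
    | begin =>
      refine ⟨fun h => (by cases h), fun q L R h => (by cases h), fun R h => ?_⟩
      simp only [Prod.mk.injEq, List.nil_append, List.append_nil, true_and] at h
      subst h
      obtain ⟨h₁, h₂⟩ := ih₂ q₀ [] R (by simp [tapeWord])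
      have h₁' : wordHom Option.toList (none :: _) = [] := h₁
      simpa [h₁'] using h₂
    | blankRight q =>
      refine ⟨fun h => (by cases h), fun q' L R h => ?_, fun R h => (by cases h)⟩
      simp only [Prod.mk.injEq, SimState.run.injEq] at h
      obtain ⟨rfl, h⟩ := h
      rcases tapeWord_eq_cons h.symm with ⟨rfl, -, rfl⟩ | ⟨b, R', rfl, e, rfl⟩
      · have h' := ih₂ q L [default] (by simp [tapeWord])
        rwa [HaltsFrom, ← mk_nil_eq_mk_default] at h'
      · cases e
    | blankLeft q =>
      refine ⟨fun h => (by cases h), fun q' L R h => ?_, fun R h => (by cases h)⟩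
      simp only [Prod.mk.injEq, SimState.run.injEq, List.nil_append] at h
      obtain ⟨rfl, h⟩ := h
      rcases tapeWord_eq_concat h.symm with ⟨rfl, -, rfl⟩ | ⟨b, L', rfl, e, rfl⟩
      · have h' := ih₂ q [default] R (by simp [tapeWord])
        rwa [HaltsFrom, ← mk_nil_eq_mk_default] at h'
      · cases e
    | write q q' a b hM =>
      refine ⟨fun h => (by cases h), fun q' L R h => ?_, fun R h => (by cases h)⟩
      simp only [Prod.mk.injEq, SimState.run.injEq] at h
      obtain ⟨rfl, h⟩ := h
      rcases tapeWord_eq_cons h.symm with ⟨rfl, e, rfl⟩ | ⟨b', R', rfl, e, rfl⟩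
      · cases e
      · cases e
        rw [haltsFrom_congr (step_write L R' hM)]
        exact ih₂ _ L (b :: R') (by simp [tapeWord])
    | right q q' a hM =>
      refine ⟨fun h => (by cases h), fun q' L R h => ?_, fun R h => (by cases h)⟩
      simp only [Prod.mk.injEq, SimState.run.injEq] at h
      obtain ⟨rfl, h⟩ := h
      rcases tapeWord_eq_cons h.symm with ⟨rfl, e, rfl⟩ | ⟨b', R', rfl, e, rfl⟩
      · cases e
      · cases e
        rw [haltsFrom_congr (step_right L R' hM)]
        exact ih₂ _ (a :: L) R' (by simp [tapeWord])
    | left q q' a b hM =>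
      refine ⟨fun h => (by cases h), fun q' L R h => ?_, fun R h => (by cases h)⟩
      simp only [Prod.mk.injEq, SimState.run.injEq] at h
      obtain ⟨rfl, h⟩ := h
      rcases tapeWord_eq_concat h.symm with ⟨rfl, e, -⟩ | ⟨b', L', rfl, e, h'⟩
      · cases e
      · cases e
        rcases tapeWord_eq_cons ((List.append_nil _).trans h').symm with
          ⟨rfl, e, rfl⟩ | ⟨a', R', rfl, e, rfl⟩
        · cases e
        · cases e
          rw [haltsFrom_congr (step_left L' R' hM)]
          exact ih₂ _ L' (b :: a :: R') (by simp [tapeWord])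
    | halt q a hM =>
      refine ⟨fun h => (by cases h), fun q' L R h => ?_, fun R h => (by cases h)⟩
      simp only [Prod.mk.injEq, SimState.run.injEq] at h
      obtain ⟨rfl, h⟩ := h
      rcases tapeWord_eq_cons h.symm with ⟨rfl, e, rfl⟩ | ⟨b', R', rfl, e, rfl⟩
      · cases e
      · cases e
        exact ⟨ih₁ rfl, haltsFrom_of_eq_none hM⟩
    | clear a =>
      exact ⟨fun _ => ih₁ rfl, fun q L R h => (by cases h), fun R h => (by cases h)⟩

theorem simulation_clear (x : List (Option Γ)) :
    ∃ v, wordHom Option.toList v = [] ∧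
      Run (simulation M hS q₀).Step (.clear, x) v (.clear, []) := by
  induction x with
  | nil => exact ⟨[], rfl, .refl _⟩
  | cons a x ih =>
    obtain ⟨v, hv, hr⟩ := ih
    exact ⟨none :: v, hv, .letter (.inl ⟨_, .clear a, x, by simp, rfl, by simp⟩) hr⟩

/-- Blanks may be added at both ends of the tape word, so a move of the Turing machine can be assumed
to find a symbol on both sides of the head. -/
theorem simulation_extend (q : S) (P : Turing.Tape Γ → Prop)
    (h : ∀ a b L R, P (.mk' (.mk (b :: L)) (.mk (a :: R))) →
      ∃ v, wordHom Option.toList v = [] ∧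
        Run (simulation M hS q₀).Step (.run q, tapeWord (b :: L) (a :: R)) v (.clear, []))
    (L R : List Γ) (hP : P (.mk' (.mk L) (.mk R))) :
    ∃ v, wordHom Option.toList v = [] ∧
      Run (simulation M hS q₀).Step (.run q, tapeWord L R) v (.clear, []) := by
  have h' : ∀ b L R, P (.mk' (.mk (b :: L)) (.mk R)) →
      ∃ v, wordHom Option.toList v = [] ∧
        Run (simulation M hS q₀).Step (.run q, tapeWord (b :: L) R) v (.clear, []) := by
    rintro b L (_ | ⟨a, R⟩) hP
    · rw [mk_nil_eq_mk_default] at hP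
      obtain ⟨v, hv, hr⟩ := h _ _ _ _ hP
      exact ⟨none :: v, hv, .letter (.inl ⟨_, .blankRight q, (b :: L).reverse.map some,
        by simp [tapeWord], rfl, by simp [tapeWord]⟩) hr⟩
    · exact h _ _ _ _ hP
  cases L with
  | nil =>
    rw [mk_nil_eq_mk_default] at hP
    obtain ⟨v, hv, hr⟩ := h' _ _ _ hP
    exact ⟨none :: v, hv, .letter (.inl ⟨_, .blankLeft q, R.map some,
      by simp [tapeWord], rfl, by simp [tapeWord]⟩) hr⟩
  | cons b L => exact h' _ _ _ hP

theorem simulation_complete (hM : Turing.TM0.Supports M S) (q : S) (L R : List Γ)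
    (h : HaltsFrom M q L R) :
    ∃ v, wordHom Option.toList v = [] ∧
      Run (simulation M hS q₀).Step (.run q, tapeWord L R) v (.clear, []) := by
  obtain ⟨d, hd⟩ := Part.dom_iff_mem.1 h
  obtain ⟨hr, hn⟩ := StateTransition.mem_eval.1 hd
  clear h hd
  have key : ∀ c, StateTransition.Reaches (Turing.TM0.step M) c d → ∀ (q : S) (L R : List Γ),
      c = ⟨q, .mk' (.mk L) (.mk R)⟩ → ∃ v, wordHom Option.toList v = [] ∧
        Run (simulation M hS q₀).Step (.run q, tapeWord L R) v (.clear, []) := by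
    intro c hr
    induction hr using Relation.ReflTransGen.head_induction_on with
    | refl =>
      intro q L R hc
      refine simulation_extend q (fun T => d = ⟨q, T⟩) ?_ L R hc
      rintro a b L R rfl
      have ha : M q a = none := by simpa [Turing.TM0.step] using hn
      obtain ⟨v, hv, hr⟩ := simulation_clear (hS := hS) (q₀ := q₀) (M := M) (tapeWord (b :: L) R)
      exact ⟨none :: v, hv, .letter (.inl ⟨_, .halt q a ha, tapeWord (b :: L) R,
        by simp [tapeWord], rfl, by simp⟩) hr⟩
    | @head c e hs _ ih =>
      intro q L R hc
      refine simulation_extend q (fun T => c = ⟨q, T⟩) ?_ L R hc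
      rintro a b L R rfl
      cases ha : M q a with
      | none => simp [Turing.TM0.step, ha] at hs
      | some x =>
        obtain ⟨q', s⟩ := x
        have hq' : q' ∈ S := hM.2 ha q.2
        rcases s with (_ | _) | b'
        · rw [step_left L R ha] at hs
          obtain ⟨v, hv, hr⟩ := ih ⟨q', hq'⟩ L (b :: a :: R) (Option.some.inj hs).symm
          exact ⟨none :: v, hv, .letter (.inl ⟨_, .left q ⟨q', hq'⟩ a b ha, tapeWord L R,
            by simp [tapeWord], rfl, by simp [tapeWord]⟩) hr⟩
        · rw [step_right _ R ha] at hs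
          obtain ⟨v, hv, hr⟩ := ih ⟨q', hq'⟩ (a :: b :: L) R (Option.some.inj hs).symm
          exact ⟨none :: v, hv, .letter (.inl ⟨_, .right q ⟨q', hq'⟩ a ha, tapeWord (b :: L) R,
            by simp [tapeWord], rfl, by simp [tapeWord]⟩) hr⟩
        · rw [step_write _ R ha] at hs
          obtain ⟨v, hv, hr⟩ := ih ⟨q', hq'⟩ (b :: L) (b' :: R) (Option.some.inj hs).symm
          exact ⟨none :: v, hv, .letter (.inl ⟨_, .write q ⟨q', hq'⟩ a b' ha,
            tapeWord (b :: L) R, by simp [tapeWord], rfl, by simp [tapeWord]⟩) hr⟩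
  exact key _ hr q L R rfl

variable (hS) in
/-- Erasing the padding letters turns the language of the simulation into the set of the words on which
the Turing machine halts. -/
theorem homImage_simulation_language (hM : Turing.TM0.Supports M S) :
    homImage Option.toList (simulation M hS ⟨default, hM.1⟩).language =
      {l | (Turing.TM0.eval M l).Dom} := by
  have halts_iff : ∀ l, (Turing.TM0.eval M l).Dom ↔ HaltsFrom M default [] l := fun l => Iff.rfl
  ext l
  change _ ↔ (Turing.TM0.eval M l).Dom
  rw [halts_iff]
  constructor
  · rintro ⟨v, ⟨_, rfl, _, rfl, h⟩, rfl⟩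
    exact (simulation_sound h).2.2 [] rfl
  · intro h
    obtain ⟨v, hv, hr⟩ := simulation_complete (hS := hS) (q₀ := ⟨default, hM.1⟩) hM
      ⟨default, hM.1⟩ [] l h
    have load : ∀ (l R : List Γ), Run (simulation M hS ⟨default, hM.1⟩).Step
        (.load, R.map some) (l.map some) (.load, (R ++ l).map some) := by
      intro l
      induction l with
      | nil => intro R; simpa using Run.refl _
      | cons a l ih =>
        intro R
        refine .letter (d := (.load, (R ++ [a]).map some))
          (.inl ⟨_, .load a, R.map some, by simp, rfl, by simp⟩) ?_
        simpa using ih (R ++ [a])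
    refine ⟨l.map some ++ none :: v, ⟨_, rfl, _, rfl, (load l []).trans (.letter
      (.inl ⟨_, .begin, l.map some, by simp, rfl, ?_⟩) hr)⟩, ?_⟩
    · simp [tapeWord]
    · have h₁ : wordHom Option.toList (l.map some) = l := by simp [wordHom, List.flatMap_map]
      have h₂ : wordHom Option.toList (l.map some ++ none :: v) =
        wordHom Option.toList (l.map some) ++ wordHom Option.toList v := by simp [wordHom]
      rw [h₂, h₁, hv, List.append_nil]

end Simulation

/-! ### Decidability of the deque languages -/

section Decidability

variable {α Γ Q : Type}

theorem Automaton.QuasiRealTimeWith.length_add_le {M : Automaton α Γ Q} {p : ℕ}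
    (hp : M.QuasiRealTimeWith p) {w : List α} {k : ℕ} {d : Config α Γ Q}
    (h : M.Moves (p * k) (M.initial w) d) : d.input.length + k ≤ w.length := by
  induction k generalizing d with
  | zero => cases h; exact le_rfl
  | succ k ih =>
    rw [Nat.mul_succ] at h
    obtain ⟨c, h₁, h₂⟩ := M.moves_add.1 h
    have := ih h₁
    have := hp w _ c d h₁ h₂
    omega

/-- Quasi-real-time operation bounds the number of moves of a computation. -/
theorem Automaton.QuasiRealTimeWith.lt_of_moves_initial {M : Automaton α Γ Q} {p : ℕ}
    (hp : M.QuasiRealTimeWith p) {w : List α} {n : ℕ} {c : Config α Γ Q}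
    (h : M.Moves n (M.initial w) c) : n < p * (w.length + 1) := by
  by_contra hn
  obtain ⟨r, rfl⟩ := Nat.exists_eq_add_of_le (not_lt.1 hn)
  obtain ⟨d, h₁, -⟩ := M.moves_add.1 h
  have := hp.length_add_le h₁
  omega

/-- The configuration given by a triple. -/
def Config.ofProd (c : Q × List α × List Γ) : Config α Γ Q := ⟨c.1, c.2.1, c.2.2⟩

/-- What `t` leaves of the deque content `x`, provided that `x` begins with `t.readFront` and ends with
`t.readTail`. -/
def Transition.middle (t : Transition α Γ Q) (x : List Γ) : List Γ :=
  (x.drop t.readFront.length).take (x.length - (t.readFront.length + t.readTail.length))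

open Classical in
/-- The list of the configurations, at most one, that `t` leads to. -/
noncomputable def Transition.next (t : Transition α Γ Q) (c : Q × List α × List Γ) :
    List (Q × List α × List Γ) :=
  if c.1 = t.src ∧ t.input.toList ++ c.2.1.drop t.input.toList.length = c.2.1 ∧
      t.readFront ++ t.middle c.2.2 ++ t.readTail = c.2.2
  then [(t.dst, c.2.1.drop t.input.toList.length,
    t.writeFront ++ t.middle c.2.2 ++ t.writeTail)]
  else []

theorem Transition.mem_next (t : Transition α Γ Q) (c d : Q × List α × List Γ) :
    d ∈ t.next c ↔ ∃ (u : List α) (γ : List Γ),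
      c = (t.src, t.input.toList ++ u, t.readFront ++ γ ++ t.readTail) ∧
      d = (t.dst, u, t.writeFront ++ γ ++ t.writeTail) := by
  rw [Transition.next]
  constructor
  · intro h
    split_ifs at h with hc
    · obtain ⟨q, u, x⟩ := c
      obtain ⟨h₁, h₂, h₃⟩ := hc
      rw [List.mem_singleton] at h
      simp only at h₁ h₂ h₃ h
      exact ⟨_, _, by rw [h₁, h₂, h₃], h⟩
    · cases h
  · rintro ⟨u, γ, rfl, rfl⟩
    have hγ : t.middle (t.readFront ++ γ ++ t.readTail) = γ := by
      have : (t.readFront ++ γ ++ t.readTail).length -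
          (t.readFront.length + t.readTail.length) = γ.length := by
        simp only [List.length_append]
        omega
      rw [Transition.middle, this, List.append_assoc, List.drop_left, List.take_left]
    simp only [hγ, List.drop_left, and_self, if_true, List.mem_singleton]

theorem Transition.primrec_next [Primcodable α] [Primcodable Γ] [Primcodable Q]
    (t : Transition α Γ Q) : Primrec t.next := by
  have hq : Primrec fun c : Q × List α × List Γ => c.1 := Primrec.fst
  have hu : Primrec fun c : Q × List α × List Γ => c.2.1 := Primrec.fst.comp Primrec.snd
  have hx : Primrec fun c : Q × List α × List Γ => c.2.2 := Primrec.snd.comp Primrec.snd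
  have hd : Primrec fun c : Q × List α × List Γ => c.2.1.drop t.input.toList.length :=
    Primrec.list_drop.comp (.const _) hu
  have hm : Primrec fun c : Q × List α × List Γ => t.middle c.2.2 :=
    Primrec.list_take.comp
      (Primrec.nat_sub.comp (Primrec.list_length.comp hx) (.const _))
      (Primrec.list_drop.comp (.const _) hx)
  have ha : ∀ l r : List Γ,
      Primrec fun c : Q × List α × List Γ => l ++ t.middle c.2.2 ++ r := fun l r =>
    Primrec.list_append.comp (Primrec.list_append.comp (.const l) hm) (.const r)
  classical
  refine Primrec.ite ?_ ?_ (.const [])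
  · exact (Primrec.eq.comp hq (.const _)).and ((Primrec.eq.comp
      (Primrec.list_append.comp (.const _) hd) hu).and (Primrec.eq.comp (ha _ _) hx))
  · exact Primrec.list_cons.comp ((Primrec.const _).pair (hd.pair (ha _ _))) (.const [])

/-- The configurations in `cs` and their successors. -/
noncomputable def Automaton.grow (M : Automaton α Γ Q) (cs : List (Q × List α × List Γ)) :
    List (Q × List α × List Γ) :=
  cs ++ cs.flatMap fun c => M.trans_finite.toFinset.toList.flatMap fun t => t.next c

theorem Automaton.mem_grow (M : Automaton α Γ Q) (cs : List (Q × List α × List Γ))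
    (d : Q × List α × List Γ) :
    d ∈ M.grow cs ↔ d ∈ cs ∨ ∃ c ∈ cs, M.Move (.ofProd c) (.ofProd d) := by
  have h : ∀ c, (∃ t ∈ M.trans, d ∈ t.next c) ↔ M.Move (.ofProd c) (.ofProd d) := by
    rintro ⟨q, u, x⟩
    obtain ⟨q', u', x'⟩ := d
    simp only [Transition.mem_next, Automaton.Move, Config.ofProd, Prod.mk.injEq,
      Config.mk.injEq]
  simp only [Automaton.grow, List.mem_append, List.mem_flatMap, Finset.mem_toList,
    Set.Finite.mem_toFinset, h]

theorem Automaton.mem_iterate_grow (M : Automaton α Γ Q) (N : ℕ)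
    (cs : List (Q × List α × List Γ)) (d : Q × List α × List Γ) :
    d ∈ M.grow^[N] cs ↔ ∃ n ≤ N, ∃ c ∈ cs, M.Moves n (.ofProd c) (.ofProd d) := by
  have hinj : ∀ c d : Q × List α × List Γ,
      (Config.ofProd c : Config α Γ Q) = .ofProd d → c = d := by
    rintro ⟨_, _, _⟩ ⟨_, _, _⟩ h
    simpa [Config.ofProd] using h
  induction N generalizing cs with
  | zero =>
    rw [Function.iterate_zero_apply]
    constructor
    · exact fun h => ⟨0, le_rfl, d, h, rfl⟩
    · rintro ⟨n, hn, c, hc, h⟩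
      obtain rfl := Nat.le_zero.1 hn
      rwa [← hinj _ _ h]
  | succ N ih =>
    rw [Function.iterate_succ_apply]
    refine (ih _).trans ?_
    constructor
    · rintro ⟨n, hn, c, hc, h⟩
      rcases (M.mem_grow _ _).1 hc with hc | ⟨b, hb, hm⟩
      · exact ⟨n, hn.trans N.le_succ, c, hc, h⟩
      · exact ⟨n + 1, Nat.succ_le_succ hn, b, hb, _, hm, h⟩
    · rintro ⟨_ | n, hn, c, hc, h⟩
      · exact ⟨0, Nat.zero_le _, c, (M.mem_grow _ _).2 (.inl hc), h⟩
      · obtain ⟨⟨q, u, x⟩, hm, h⟩ := h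
        exact ⟨n, Nat.le_of_succ_le_succ hn, (q, u, x),
          (M.mem_grow _ _).2 (.inr ⟨c, hc, hm⟩), h⟩

theorem Automaton.primrec_grow [Primcodable α] [Primcodable Γ] [Primcodable Q]
    (M : Automaton α Γ Q) : Primrec M.grow := by
  have h : ∀ ts : List (Transition α Γ Q),
      Primrec fun c : Q × List α × List Γ => ts.flatMap fun t => t.next c := by
    intro ts
    induction ts with
    | nil => exact .const []
    | cons t ts ih => exact Primrec.list_append.comp t.primrec_next ih
  exact Primrec.list_append.comp .id (Primrec.list_flatMap .id ((h _).comp Primrec.snd))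

/-- A finite type, encoded through an enumeration of its elements. -/
noncomputable abbrev primcodableOfFinite (α : Type) [Finite α] : Primcodable α :=
  .ofEquiv (Fin (Nat.card α)) (Finite.equivFin α)

/-- Deque languages are decidable: a word of length `n` is accepted within `p * (n + 1)` moves or not
at all, so it suffices to list the configurations that are reachable with so many moves. -/
theorem computablePred_of_mem_dequeLanguages [Finite α] [Primcodable α] {L : Language α}
    (hL : L ∈ dequeLanguages α) : ComputablePred fun w => w ∈ L := by
  obtain ⟨Γ, Q, _, _, M, ⟨p, _, hp⟩, rfl⟩ := hL
  let _ := primcodableOfFinite Γ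
  let _ := primcodableOfFinite Q
  have hrun : Primrec fun w : List α => M.grow^[p * (w.length + 1)] [(M.start, w, [])] :=
    Primrec.nat_iterate
      (Primrec.nat_mul.comp (.const p) (Primrec.succ.comp Primrec.list_length))
      (Primrec.list_cons.comp ((Primrec.const _).pair (Primrec.id.pair (.const []))) (.const []))
      (M.primrec_grow.comp Primrec.snd)
  have hacc : PrimrecPred fun c : Q × List α × List Γ =>
      c.1 ∈ M.final ∧ c.2.1 = [] ∧ c.2.2 = [] := by
    classical
    refine PrimrecPred.and ?_ ((Primrec.eq.comp (Primrec.fst.comp Primrec.snd) (.const [])).and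
      (Primrec.eq.comp (Primrec.snd.comp Primrec.snd) (.const [])))
    have h : PrimrecPred fun q : Q => q ∈ M.final :=
      (Primrec.dom_finite fun q : Q => decide (q ∈ M.final)).primrecPred
    exact h.comp Primrec.fst
  refine PrimrecPred.computablePred ((hacc.exists_mem_list.comp hrun).of_eq fun w => ?_)
  simp only [M.mem_iterate_grow]
  constructor
  · rintro ⟨⟨q, u, x⟩, ⟨n, -, c, hc, h⟩, hq, hu, hx⟩
    obtain rfl := List.mem_singleton.1 hc
    simp only at hq hu hx
    subst hu hx
    exact ⟨n, q, hq, h⟩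
  · rintro ⟨n, q, hq, h⟩
    exact ⟨(q, [], []), ⟨n, (hp.lt_of_moves_initial h).le, _, List.mem_singleton_self _, h⟩,
      hq, rfl, rfl⟩

end Decidability

/-! ### An undecidable halting set of a Turing machine -/

section Undecidability

open Turing PartrecToTM2

theorem trNat_two_mul_add_one (n : ℕ) : trNat (2 * n + 1) = Γ'.bit1 :: trNat n := by
  have h : ((2 * n + 1 : ℕ) : Num) = Num.bit1 (n : Num) := by
    apply Num.to_nat_inj.1
    rw [Num.cast_bit1, Num.to_of_nat, Num.to_of_nat]
  rw [trNat, trNat, h]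
  cases (n : Num) <;> rfl

theorem trNat_two_mul {n : ℕ} (hn : n ≠ 0) : trNat (2 * n) = Γ'.bit0 :: trNat n := by
  have h : ((2 * n : ℕ) : Num) = Num.bit0 (n : Num) := by
    apply Num.to_nat_inj.1
    rw [Num.cast_bit0, Num.to_of_nat, Num.to_of_nat]
  rw [trNat, trNat, h]
  cases hm : (n : Num) with
  | zero =>
    exact absurd (by simpa using congrArg (fun m : Num => (m : ℕ)) hm) hn
  | pos m => rfl

noncomputable instance : Primcodable Γ' := primcodableOfFinite Γ'

/-- The binary notation of a natural number on the tape is primitive recursive. -/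
theorem primrec_trNat : Primrec trNat := by
  let g : List (List Γ') → Option (List Γ') := fun l =>
    bif l.length == 0 then some [] else
      l[l.length.div2]?.map (List.cons (bif l.length.bodd then Γ'.bit1 else Γ'.bit0))
  have hlen : Primrec fun l : List (List Γ') => l.length := Primrec.list_length
  have hg : Primrec g := by
    refine Primrec.cond (Primrec.beq.comp hlen (.const 0)) (.const _) ?_
    refine Primrec.option_map (Primrec.list_getElem?.comp .id (Primrec.nat_div2.comp hlen)) ?_
    exact Primrec.list_cons.comp
      (Primrec.cond (Primrec.nat_bodd.comp (hlen.comp Primrec.fst)) (.const _) (.const _))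
      Primrec.snd
  have h : Primrec₂ fun (_ : Unit) n => trNat n := by
    -- `g` computes the notation of `n` from the list of the notations of all smaller numbers
    refine Primrec.nat_strong_rec (fun (_ : Unit) n => trNat n)
      (g := fun _ l => g l) (hg.comp Primrec.snd) fun _ n => ?_
    simp only [g, List.length_map, List.length_range]
    rcases Nat.eq_zero_or_pos n with rfl | hn
    · simp
    · have hlt : n.div2 < n := by rw [Nat.div2_val]; omega
      have hne : (n == 0) = false := by simp; omega
      rw [hne, cond_false, List.getElem?_map, List.getElem?_range hlt]
      have hb := Nat.bodd_add_div2 n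
      cases hbo : n.bodd with
      | true =>
        rw [hbo] at hb
        simp only [Bool.toNat_true] at hb
        conv_rhs => rw [← hb, add_comm, trNat_two_mul_add_one]
        rfl
      | false =>
        rw [hbo] at hb
        simp only [Bool.toNat_false, zero_add] at hb
        conv_rhs => rw [← hb, trNat_two_mul (by omega)]
        rfl
  exact h.comp (.const ()) .id

/-- The tape alphabet of the one-tape simulation of a machine with the stacks of `PartrecToTM2`. -/
abbrev TapeAlphabet : Type := TM2to1.Γ' K' fun _ => Γ'

instance : Finite K' := by
  refine Finite.of_surjective (fun i : Fin 4 => ![K'.main, .rev, .aux, .stack] i) ?_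
  rintro (_ | _ | _ | _)
  exacts [⟨0, rfl⟩, ⟨1, rfl⟩, ⟨2, rfl⟩, ⟨3, rfl⟩]

instance : Finite TapeAlphabet :=
  inferInstanceAs (Finite (Bool × (K' → Option Γ')))

noncomputable instance : Primcodable TapeAlphabet := primcodableOfFinite TapeAlphabet

/-- The initial tape for the input `n`. -/
def inputTape (n : ℕ) : List TapeAlphabet :=
  TM2to1.trInit (K := K') (Γ := fun _ => Γ') K'.main (trList [n])

theorem computable_inputTape : Computable inputTape := by
  let cell (a : Γ') : TapeAlphabet := (false, Function.update (fun _ => none) K'.main (some a))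
  let bottom (a : TapeAlphabet) : TapeAlphabet := (true, a.2)
  have h₁ : Primrec fun n : ℕ => trList [n] :=
    (Primrec.list_append.comp primrec_trNat (.const [Γ'.cons])).of_eq fun n => by simp
  have h₂ : Primrec fun n : ℕ => (trList [n]).reverse.map cell :=
    Primrec.list_map (Primrec.list_reverse.comp h₁)
      ((Primrec.dom_finite cell).comp Primrec.snd)
  have h₃ : Primrec fun n : ℕ => bottom ((trList [n]).reverse.map cell).headI ::
      ((trList [n]).reverse.map cell).tail :=
    Primrec.list_cons.comp ((Primrec.dom_finite bottom).comp (Primrec.list_headI.comp h₂))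
      (Primrec.list_tail.comp h₂)
  exact h₃.to_comp

/-- Some Turing machine with finitely many states has an undecidable halting set. -/
theorem exists_turingMachine_not_computablePred :
    ∃ (Λ : Type) (_ : Inhabited Λ) (M : TM0.Machine TapeAlphabet Λ) (S : Set Λ),
      S.Finite ∧ TM0.Supports M S ∧
        ¬ ComputablePred fun l : List TapeAlphabet => (TM0.eval M l).Dom := by
  have hf : Partrec fun n : ℕ =>
      Nat.Partrec.Code.eval (Denumerable.ofNat Nat.Partrec.Code n) 0 :=
    Nat.Partrec.Code.eval_part.comp (Computable.ofNat _) (Computable.const 0)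
  obtain ⟨c, hc⟩ := ToPartrec.Code.exists_code (Nat.Partrec'.part_iff₁.2 hf)
  -- the default label is the initial one
  let _ : Inhabited Λ' := ⟨trNormal c Cont'.halt⟩
  obtain ⟨M₂, hM₂⟩ : ∃ M₂ : Λ' → TM2.Stmt (fun _ : K' => Γ') Λ' (Option Γ'),
    M₂ = PartrecToTM2.tr := ⟨_, rfl⟩
  have hS₂ : TM2.Supports M₂ (codeSupp c Cont'.halt) := hM₂ ▸ PartrecToTM2.tr_supports c Cont'.halt
  have hS₁ := TM2to1.tr_supports M₂ hS₂
  have hS₀ := TM1to0.tr_supports _ hS₁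
  refine ⟨_, inferInstance, _, _, Finset.finite_toSet _, hS₀, fun h => ?_⟩
  have hdom : ∀ n, (TM0.eval (TM1to0.tr (TM2to1.tr M₂)) (inputTape n)).Dom ↔
      (Nat.Partrec.Code.eval (Denumerable.ofNat Nat.Partrec.Code n) 0).Dom := by
    intro n
    rw [TM1to0.tr_eval, inputTape, TM2to1.tr_eval_dom]
    have hinit : TM2.init (Γ := fun _ : K' => Γ') (Λ := Λ') (σ := Option Γ') K'.main (trList [n]) =
        PartrecToTM2.init c [n] := by
      simp only [TM2.init, PartrecToTM2.init]
      congr 1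
      funext k
      cases k <;> rfl
    have heval := PartrecToTM2.tr_eval c [n]
    have hcn := hc (n ::ᵥ List.Vector.nil)
    subst hM₂
    change (StateTransition.eval (TM2.step PartrecToTM2.tr) (TM2.init K'.main (trList [n]))).Dom ↔ _
    rw [hinit, heval, show [n] = (n ::ᵥ List.Vector.nil).1 from rfl, hcn]
    rfl
  refine ComputablePred.halting_problem 0 (ComputablePred.computable_of_manyOneReducible
    ⟨fun c => inputTape (Encodable.encode c),
      computable_inputTape.comp Computable.encode, fun c => ?_⟩ h)
  rw [hdom, Denumerable.ofNat_encode]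

end Undecidability

theorem not_closedUnderHom_dequeLanguages : ¬ ClosedUnderHom dequeLanguages := by
  intro h
  obtain ⟨Λ, _, M, S, hS, hM, hund⟩ := exists_turingMachine_not_computablePred
  have := SimState.finite hS
  have hmem := h _ _ Option.toList _ (mem_dequeLanguages_iff.2
    ⟨_, _, inferInstance, inferInstance, simulation M hS ⟨default, hM.1⟩, rfl⟩)
  rw [homImage_simulation_language hS hM] at hmem
  exact hund (computablePred_of_mem_dequeLanguages hmem)

end DequeAFL

theorem mainTheorem5 :
    DequeAFL.IsAFL DequeAFL.dequeLanguages ∧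
    DequeAFL.ClosedUnderKleeneStar DequeAFL.dequeLanguages ∧
    ¬ DequeAFL.ClosedUnderHom DequeAFL.dequeLanguages ∧
    ¬ DequeAFL.IsFullAFL DequeAFL.dequeLanguages :=
  ⟨DequeAFL.isAFL_dequeLanguages, DequeAFL.closedUnderKleeneStar_dequeLanguages,
    DequeAFL.not_closedUnderHom_dequeLanguages,
    fun h => DequeAFL.not_closedUnderHom_dequeLanguages h.hom⟩
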